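/- **Central limit theorem.** Let $d\ge 1$, let $\mathbb{R}^d$ be equipped with the metric $\rho$ of some norm, and let $D\subset\mathbb{R}^d$ be a countably infinite set such that $\rho(i,j)\ge\rho_0$ for all distinct $i,j\in D$, for some $\rho_0>0$. Let $D_n\subset D$ ($n\ge 1$) be finite sets with $|D_n|\to\infty$. For each $n$ let $(X_{i,n})_{i\in D_n}$ be zero-mean real-valued random variables on a common probability space (which may depend on $n$; no stationarity is assumed). *Dependence coefficients.* For $f:\mathbb{R}^u\to\mathbb{R}$ let $\mathrm{Lip}(f)=\sup_{x\ne y}|f(x)-f(y)|/\sum_k|x_k-y_k|$. For finite $U,V\subset D_n$ write $X_U=(X_{i,n})_{i\in U}$, $\rho(U,V)=\min_{i\in U,j\in V}\rho(i,j)$ (so that $\rho(U,V)\ge s$ holds trivially if $U$ or $V$ is empty), and let $\|f\|_\infty=\inf\{C>0:\mathbb{P}(|f(X_U)|\le C)=1\}$, $\|g\|_\infty=\inf\{C>0:\mathbb{P}(|g(X_V)|\le C)=1\}$. Define $$\bar\theta_{u,v}(s)=\sup\frac{|\mathrm{Cov}(f(X_U),g(X_V))|}{v\,\|f\|_\infty\mathrm{Lip}(g)},\qquad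 \bar\eta_{u,v}(s)=\sup\frac{|\mathrm{Cov}(f(X_U),g(X_V))|}{u\,\|g\|_\infty\mathrm{Lip}(f)+v\,\|f\|_\infty\mathrm{Lip}(g)},$$ where the suprema run over all $n$, all $U,V\subset D_n$ with $|U|=u$, $|V|=v$, $\rho(U,V)\ge s$, and, for $\bar\theta$, all measurable $f:\mathbb{R}^u\to\mathbb{R}$ with $\|f\|_\infty<\infty$ and all $g:\mathbb{R}^v\to\mathbb{R}$ with $\mathrm{Lip}(g)<\infty$; for $\bar\eta$, all $f,g$ with $\|f\|_\infty,\|g\|_\infty,\mathrm{Lip}(f),\mathrm{Lip}(g)<\infty$ (with $0/0=0$ and the supremum of the empty set equal to $0$). *Assumptions.* Let $m>2$, let $c_{i,n}>0$ ($i\in D_n$, $n\ge1$) be constants, and put $M_n=\sup_{i\in D_n}c_{i,n}$, $S_n=\sum_{i\in D_n}X_{i,n}$, $\sigma_n^2=\mathrm{Var}(S_n)$. Assume: 1. $\sup_n\sup_{i\in D_n}\mathbb{E}|X_{i,n}/c_{i,n}|^m<\infty$; 2. $\liminf_{n\to\infty}M_n>0$ (the $M_n$ may be unbounded); 3. $\liminf_{n\to\infty}|D_n|^{-1}M_n^{-2}\sigma_n^2>0$;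 4. at least one of the following holds as $s\to\infty$: - ($\theta$) $\bar\theta_{u,v}(s)=O(s^{-\alpha})$ for all $u+v\le 4$, for some $\alpha>\frac{m-1}{m-2}d$, and $\sup_u\bar\theta_{u,1}(s)=O(s^{-\beta})$ for some $\beta>d$; - ($\eta$) $\bar\eta_{u,v}(s)=O(s^{-\alpha})$ for all $u+v\le 4$, for some $\alpha>\frac{m-1}{m-2}d$, and $\sup_u\bar\eta_{u,1}(s)=O(s^{-\beta})$ for some $\beta>2d$. Then $\sigma_n^{-1}S_n$ converges in distribution to $N(0,1)$ as $n\to\infty$. -/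

import Mathlib

open MeasureTheory ProbabilityTheory Filter Topology
open scoped ENNReal NNReal

noncomputable section

namespace WeakDep

/-- A countably infinite set of sites with a positive minimum distance between distinct sites. -/
structure IsLattice {E : Type*} [PseudoMetricSpace E] (D : Set E) : Prop where
  countable : D.Countable
  infinite : D.Infinite
  separated : ∃ ρ₀ : ℝ, 0 < ρ₀ ∧ ∀ i ∈ D, ∀ j ∈ D, i ≠ j → ρ₀ ≤ dist i j

/-- The Lipschitz constant of `f : ℝ^ι → ℝ` with respect to the `ℓ¹` distance, with value `∞`
when `f` is not Lipschitz. -/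
def lip {ι : Type*} [Fintype ι] (f : (ι → ℝ) → ℝ) : ℝ≥0∞ :=
  ⨆ (x : ι → ℝ) (y : ι → ℝ) (_ : x ≠ y), ENNReal.ofReal (|f x - f y| / ∑ k, |x k - y k|)

/-- The essential supremum `inf {C > 0 : P(|Z| ≤ C) = 1}` of `|Z|`, with value `∞` when `Z` is
not essentially bounded. -/
def supNorm {Ω : Type*} [MeasurableSpace Ω] (μ : Measure Ω) (Z : Ω → ℝ) : ℝ≥0∞ :=
  sInf {C : ℝ≥0∞ | ∀ᵐ ω ∂μ, ENNReal.ofReal |Z ω| ≤ C}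

section coefficients

variable {E : Type*} {Ω : Type*} [MeasurableSpace Ω]

/-- The random vector `(X i)_{i ∈ U}`. -/
def restr (X : E → Ω → ℝ) (U : Finset E) (ω : Ω) : U → ℝ := fun i => X i ω

/-- `θ`-dependence between `(X i)_{i ∈ U}` and `(X i)_{i ∈ V}`: the supremum of
`|Cov(f(X_U), g(X_V))| / (|V| ‖f‖_∞ Lip g)` over bounded measurable `f` and Lipschitz `g`.
Whenever the denominator vanishes so does the covariance, and the quotient `0 / 0` is `0`. -/
def thetaPair (μ : Measure Ω) (X : E → Ω → ℝ) (U V : Finset E) : ℝ≥0∞ :=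
  ⨆ (f : (U → ℝ) → ℝ) (g : (V → ℝ) → ℝ)
    (_ : Measurable f ∧ supNorm μ (fun ω => f (restr X U ω)) < ∞ ∧ lip g < ∞),
    ENNReal.ofReal |covariance (fun ω => f (restr X U ω)) (fun ω => g (restr X V ω)) μ| /
      ((V.card : ℝ≥0∞) * supNorm μ (fun ω => f (restr X U ω)) * lip g)

/-- `η`-dependence between `(X i)_{i ∈ U}` and `(X i)_{i ∈ V}`: the supremum of
`|Cov(f(X_U), g(X_V))| / (|U| ‖g‖_∞ Lip f + |V| ‖f‖_∞ Lip g)` over bounded Lipschitz `f`, `g`. -/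
def etaPair (μ : Measure Ω) (X : E → Ω → ℝ) (U V : Finset E) : ℝ≥0∞ :=
  ⨆ (f : (U → ℝ) → ℝ) (g : (V → ℝ) → ℝ)
    (_ : (supNorm μ (fun ω => f (restr X U ω)) < ∞ ∧ lip f < ∞) ∧
      (supNorm μ (fun ω => g (restr X V ω)) < ∞ ∧ lip g < ∞)),
    ENNReal.ofReal |covariance (fun ω => f (restr X U ω)) (fun ω => g (restr X V ω)) μ| /
      ((U.card : ℝ≥0∞) * supNorm μ (fun ω => g (restr X V ω)) * lip f +
        (V.card : ℝ≥0∞) * supNorm μ (fun ω => f (restr X U ω)) * lip g)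

end coefficients

section arrays

variable {E : Type*} [PseudoMetricSpace E] {Ω : ℕ → Type*} [∀ n, MeasurableSpace (Ω n)]

/-- The uniform coefficient `sup_n ε_{n,u,v}(s)`, where `ε_{n,u,v}(s)` is the supremum of
`pair n U V` over `U, V ⊆ D n` with `|U| = u`, `|V| = v` at distance at least `s`. -/
def unifCoeff (D : ℕ → Finset E) (pair : ℕ → Finset E → Finset E → ℝ≥0∞) (u v : ℕ) (s : ℝ) :
    ℝ≥0∞ :=
  ⨆ (n : ℕ) (U : Finset E) (V : Finset E)
    (_ : U ⊆ D n ∧ V ⊆ D n ∧ U.card = u ∧ V.card = v ∧ ∀ i ∈ U, ∀ j ∈ V, s ≤ dist i j),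
    pair n U V

/-- The coefficients `θ̄_{u,v}(s)` of the array `{X n i : i ∈ D n}`. -/
def thetaBar (μ : ∀ n, Measure (Ω n)) (D : ℕ → Finset E) (X : ∀ n, E → Ω n → ℝ) :
    ℕ → ℕ → ℝ → ℝ≥0∞ :=
  unifCoeff D (fun n => thetaPair (μ n) (X n))

/-- The coefficients `η̄_{u,v}(s)` of the array `{X n i : i ∈ D n}`. -/
def etaBar (μ : ∀ n, Measure (Ω n)) (D : ℕ → Finset E) (X : ∀ n, E → Ω n → ℝ) :
    ℕ → ℕ → ℝ → ℝ≥0∞ :=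
  unifCoeff D (fun n => etaPair (μ n) (X n))

end arrays

/-- `ε(s) = O(s^{-a})` as `s → ∞`. -/
def IsBigOPow (ε : ℝ → ℝ≥0∞) (a : ℝ) : Prop :=
  ∃ C : ℝ≥0, ∀ᶠ s : ℝ in atTop, ε s ≤ C * ENNReal.ofReal (s ^ (-a))

/-- Polynomial decay of a family `ε u v s` of dependence coefficients: `ε_{u,v}(s) = O(s^{-α})`
for all `u + v ≤ 4`, with `α > d (m-1)/(m-2)`, and `sup_u ε_{u,1}(s) = O(s^{-β})`, with
`β > b`. -/
def PolyDecay (ε : ℕ → ℕ → ℝ → ℝ≥0∞) (d : ℕ) (m b : ℝ) : Prop :=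
  (∃ α : ℝ, (m - 1) / (m - 2) * d < α ∧ ∀ u v : ℕ, u + v ≤ 4 → IsBigOPow (ε u v) α) ∧
  (∃ β : ℝ, b < β ∧ IsBigOPow (fun s => ⨆ u : ℕ, ε u 1 s) β)

/-- `M_n = sup_{i ∈ D_n} c_{i,n}` (a maximum, as `D_n` is finite). -/
def scale {E : Type*} (D : ℕ → Finset E) (c : ℕ → E → ℝ) (n : ℕ) : ℝ := ⨆ i : D n, c n i

/-- `S_n = ∑_{i ∈ D_n} X_{i,n}`. -/
def partialSum {E : Type*} {Ω : ℕ → Type*} (D : ℕ → Finset E) (X : ∀ n, E → Ω n → ℝ) (n : ℕ)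
    (ω : Ω n) : ℝ := ∑ i ∈ D n, X n i ω

end WeakDep

end

/-! The proof is Stein's method for characteristic functions, applied to truncated variables. Divide
by `M_n` to get `Y`; since `M_n` is bounded below, this costs only a constant in the dependence
bounds, and now `Var(∑ Y) ≥ c₀ |D_n|` with uniformly bounded `m`-th moments.

Truncation converts dependence coefficients into covariance bounds. Clipping a pair at distance `s`
at level `s^(α/(m-1))` balances the coefficient against the moment tail and gives decay `s^(-a)`
with `a = α(m-2)/(m-1) > d` (`WeakArray.abs_cov_le`), which is summable over a separated set.
Interpolating with the bound `T^(-(m-2))` for a tail beyond `T` keeps summability, with an exponent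
`b` in `(d, a)`, and gains a negative power of `T` (`WeakArray.abs_cov_tail_le`). Hence replacing
`Y` by its centred truncation `Z` at a fixed level `T` changes the sum, and its variance, by a
proportion that is small uniformly in `n`.

For `W = σ⁻¹ ∑ Z i` with characteristic function `φ`, it suffices that `φ' + tφ` be small, because
the exact equation has the Gaussian solution (`norm_integral_exp_sub_le`). Split the sum around each
`i` into the sites within `r = |D_n|^γ` and the rest. Expanding the exponential in the near part
leaves three errors (`norm_stein_le`): a covariance between `Z i` and a function of the far part;
the `L¹` fluctuation about `1` of `σ⁻² ∑ Z i ∑_{near} Z j`; and a quadratic Taylor remainder. The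
fluctuation needs covariances of products of two variables, hence functions of at most four
variables (`WeakArray.variance_sum_trunc_mul_le`). It and the remainder vanish when `γd < 1/2`. The
far covariance must be `o(|D_n|^(-1/2))`, which asks for `γβ > 1/2` under `θ`-dependence and `γβ >
1` under `η`-dependence; this is where `β > d` and `β > 2d` come from. Letting `n → ∞` with `T`
fixed, then `T → ∞`, ends the proof. -/

noncomputable section

namespace WeakDep

/-! ### Summation and counting over separated sets. -/

/-- In a separated set, the sums `∑ⱼ (1 + dist i j)⁻ᵃ` are bounded uniformly in `i` when `a`
exceeds the dimension. -/
theorem IsLattice.exists_sum_le {E : Type*} [NormedAddCommGroup E] [NormedSpace ℝ E]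
    [FiniteDimensional ℝ E] {L : Set E} (hL : IsLattice L) {a : ℝ}
    (ha : (Module.finrank ℝ E : ℝ) < a) :
    ∃ C : ℝ, 0 < C ∧ ∀ (i : E) (F : Finset E), (F : Set E) ⊆ L →
      ∑ j ∈ F, (1 + dist i j) ^ (-a) ≤ C := by
  borelize E
  obtain ⟨ρ₀, hρ₀, hsep⟩ := hL.separated
  set ν : Measure E := Measure.addHaar with hν
  set ρ : ℝ := ρ₀ / 2 with hρ
  have hρpos : 0 < ρ := by positivity
  have ha0 : 0 < a := lt_of_le_of_lt (Nat.cast_nonneg _) ha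
  have hint : Integrable (fun x : E => (1 + ‖x‖) ^ (-a)) ν := integrable_one_add_norm ha
  set I : ℝ := ∫ x, (1 + ‖x‖) ^ (-a) ∂ν with hI
  have hI0 : 0 ≤ I := integral_nonneg fun x => by positivity
  set w : ℝ := ν.real (Metric.ball (0 : E) ρ) with hw
  have hw0 : 0 < w := by
    rw [hw, measureReal_def]
    exact ENNReal.toReal_pos (Metric.measure_ball_pos ν _ hρpos).ne' measure_ball_lt_top.ne
  refine ⟨(1 + ρ) ^ a * I / w + 1, by positivity, fun i F hF => ?_⟩
  have hinti : Integrable (fun x : E => (1 + ‖x - i‖) ^ (-a)) ν := hint.comp_sub_right i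
  have hball : ∀ j, ν.real (Metric.ball j ρ) = w := fun j => by
    rw [hw, measureReal_def, measureReal_def, Measure.addHaar_ball_center]
  -- Integral comparison: on the ball of radius `ρ₀ / 2` about `j` the integrand is at least a fixed
  -- multiple of its value at `j`. These balls are disjoint and have equal volume, so the sum is
  -- dominated by an integral that does not depend on `i`.
  have hterm : ∀ j ∈ F, (1 + dist i j) ^ (-a) * w ≤
      (1 + ρ) ^ a * ∫ x in Metric.ball j ρ, (1 + ‖x - i‖) ^ (-a) ∂ν := by
    intro j _
    rw [← integral_const_mul]
    calc (1 + dist i j) ^ (-a) * w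
        = ∫ x in Metric.ball j ρ, (1 + dist i j) ^ (-a) ∂ν := by
          rw [setIntegral_const, hball, smul_eq_mul, mul_comm]
      _ ≤ _ := by
          refine setIntegral_mono_on (integrableOn_const measure_ball_lt_top.ne)
            (hinti.const_mul _).integrableOn measurableSet_ball fun x hx => ?_
          have h1 : ‖x - i‖ ≤ dist i j + ρ := by
            rw [← dist_eq_norm]
            calc dist x i ≤ dist x j + dist j i := dist_triangle _ _ _
              _ ≤ dist i j + ρ := by
                rw [dist_comm j i]; linarith [Metric.mem_ball.1 hx]
          have h2 : 1 + ‖x - i‖ ≤ (1 + ρ) * (1 + dist i j) := by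
            nlinarith [dist_nonneg (x := i) (y := j)]
          have h3 : (1 + ‖x - i‖) ^ a ≤ (1 + ρ) ^ a * (1 + dist i j) ^ a := by
            rw [← Real.mul_rpow (by positivity) (by positivity)]
            exact Real.rpow_le_rpow (by positivity) h2 ha0.le
          rw [Real.rpow_neg (by positivity), Real.rpow_neg (by positivity), inv_eq_one_div,
            ← div_eq_mul_inv, div_le_div_iff₀ (by positivity) (by positivity)]
          linarith
  have hdisj : Set.PairwiseDisjoint (F : Set E) (fun j => Metric.ball j ρ) := by
    intro j hj k hk hjk
    exact Metric.ball_disjoint_ball (by linarith [hsep j (hF hj) k (hF hk) hjk])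
  have hsum : ∑ j ∈ F, ∫ x in Metric.ball j ρ, (1 + ‖x - i‖) ^ (-a) ∂ν ≤ I := by
    rw [← integral_biUnion_finset F (fun _ _ => measurableSet_ball) hdisj
      (fun _ _ => hinti.integrableOn)]
    calc _ ≤ ∫ x, (1 + ‖x - i‖) ^ (-a) ∂ν :=
          setIntegral_le_integral hinti (Eventually.of_forall fun x => by positivity)
      _ = I := integral_sub_right_eq_self (fun x : E => (1 + ‖x‖) ^ (-a)) i
  have : (∑ j ∈ F, (1 + dist i j) ^ (-a)) * w ≤ (1 + ρ) ^ a * I := by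
    rw [Finset.sum_mul]
    calc _ ≤ ∑ j ∈ F, (1 + ρ) ^ a * ∫ x in Metric.ball j ρ, (1 + ‖x - i‖) ^ (-a) ∂ν :=
          Finset.sum_le_sum hterm
      _ ≤ _ := by
          rw [← Finset.mul_sum]
          exact mul_le_mul_of_nonneg_left hsum (by positivity)
  have := (le_div_iff₀ hw0).2 this
  linarith

/-- A bound for `∑ⱼ (1 + dist i j)⁻ᵃ` controls the number of points in a ball. -/
theorem card_filter_dist_le {E : Type*} [PseudoMetricSpace E] {F : Finset E} {i : E} {a C : ℝ}
    (ha : 0 ≤ a) (hC : ∑ j ∈ F, (1 + dist i j) ^ (-a) ≤ C) {r : ℝ} (hr : 0 ≤ r) :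
    ((F.filter (fun j => dist i j ≤ r)).card : ℝ) ≤ C * (1 + r) ^ a := by
  have h1 : ∑ j ∈ F.filter (fun j => dist i j ≤ r), (1 + r) ^ (-a) ≤ C := by
    refine le_trans (Finset.sum_le_sum fun j hj => ?_)
      (le_trans (Finset.sum_le_sum_of_subset_of_nonneg (Finset.filter_subset _ F)
        fun j _ _ => by positivity) hC)
    exact Real.rpow_le_rpow_of_nonpos (by positivity) (by linarith [(Finset.mem_filter.1 hj).2])
      (by linarith)
  rw [Finset.sum_const, nsmul_eq_mul, Real.rpow_neg (by positivity), ← div_eq_mul_inv,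
    div_le_iff₀ (by positivity)] at h1
  exact h1

/-! ### Truncation and elementary power inequalities. -/

/-- Truncation of a real number to `[-T, T]`. -/
def clip (T y : ℝ) : ℝ := max (-T) (min T y)

theorem abs_clip_le {T : ℝ} (hT : 0 ≤ T) (y : ℝ) : |clip T y| ≤ T := by
  unfold clip
  rw [abs_le]
  exact ⟨le_max_left _ _, max_le (by linarith) (min_le_left _ _)⟩

theorem abs_clip_sub_clip_le (T x y : ℝ) : |clip T x - clip T y| ≤ |x - y| := by
  unfold clip
  calc _ ≤ |min T x - min T y| := by simpa using abs_max_sub_max_le_max (-T) (min T x) (-T) (min T y)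
    _ ≤ |x - y| := by simpa using abs_min_sub_min_le_max T x T y

theorem clip_eq_self {T y : ℝ} (h : |y| ≤ T) : clip T y = y := by
  rw [abs_le] at h
  rw [clip, min_eq_right h.2, max_eq_right h.1]

theorem clip_zero {T : ℝ} (hT : 0 ≤ T) : clip T 0 = 0 := clip_eq_self (by simpa using hT)

theorem abs_sub_clip_le_abs {T : ℝ} (hT : 0 ≤ T) (y : ℝ) : |y - clip T y| ≤ |y| := by
  unfold clip
  rcases le_total T y with h | h
  · rw [min_eq_left h, max_eq_right (by linarith), abs_of_nonneg (by linarith),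
      abs_of_nonneg (by linarith)]
    linarith
  · rw [min_eq_right h]
    rcases le_total (-T) y with h' | h'
    · rw [max_eq_right h']; simp
    · rw [max_eq_left h', abs_of_nonpos (by linarith), abs_of_nonpos (by linarith)]
      linarith

theorem abs_sub_sub_clip_le (T x y : ℝ) : |(x - clip T x) - (y - clip T y)| ≤ |x - y| := by
  have key : ∀ x y : ℝ, x ≤ y → clip T x ≤ clip T y ∧ clip T y - clip T x ≤ y - x := by
    intro x y h
    constructor
    · exact max_le_max le_rfl (min_le_min le_rfl h)
    · have := abs_clip_sub_clip_le T y x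
      rw [abs_of_nonneg (by linarith : 0 ≤ y - x)] at this
      exact (le_abs_self _).trans this
  rcases le_total x y with h | h
  · obtain ⟨h1, h2⟩ := key x y h
    rw [abs_of_nonpos (by linarith), abs_of_nonpos (by linarith)]
    linarith
  · obtain ⟨h1, h2⟩ := key y x h
    rw [abs_of_nonneg (by linarith), abs_of_nonneg (by linarith)]
    linarith

/-- The left side vanishes unless `|y| > T`, and then `(|y| / T)^(m-2) ≥ 1`. Stopping at the power
`m - 1` leaves room for one further factor within `m` moments. -/
theorem abs_sub_clip_le_rpow {T m : ℝ} (hT : 0 < T) (hm : 2 ≤ m) (y : ℝ) :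
    |y - clip T y| ≤ T ^ (-(m - 2)) * |y| ^ (m - 1) := by
  rcases le_or_gt |y| T with h | h
  · rw [clip_eq_self h]; simp; positivity
  · refine (abs_sub_clip_le_abs hT.le y).trans ?_
    have hy : 0 < |y| := hT.trans h
    have h1 : T ^ (m - 2) ≤ |y| ^ (m - 2) := Real.rpow_le_rpow hT.le h.le (by linarith)
    rw [Real.rpow_neg hT.le, ← div_eq_inv_mul, le_div_iff₀ (by positivity)]
    calc |y| * T ^ (m - 2) ≤ |y| * |y| ^ (m - 2) := by gcongr
      _ = |y| ^ (m - 1) := by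
        rw [show m - 1 = 1 + (m - 2) by ring, Real.rpow_add hy, Real.rpow_one]

/-- A crude Young inequality: replace the smaller of `x`, `y` by the larger. -/
theorem rpow_mul_le_add {x y p : ℝ} (hx : 0 ≤ x) (hy : 0 ≤ y) (hp : 1 ≤ p) :
    x ^ (p - 1) * y ≤ x ^ p + y ^ p := by
  have key : ∀ z : ℝ, 0 ≤ z → z ^ (p - 1) * z = z ^ p := fun z hz => by
    rcases hz.eq_or_lt with rfl | hz
    · rw [mul_zero, Real.zero_rpow (by linarith)]
    · rw [← Real.rpow_add_one hz.ne']; congr 1; ring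
  rcases le_total x y with h | h
  · calc x ^ (p - 1) * y ≤ y ^ (p - 1) * y := by gcongr
      _ = y ^ p := key y hy
      _ ≤ _ := le_add_of_nonneg_left (by positivity)
  · calc x ^ (p - 1) * y ≤ x ^ (p - 1) * x := by gcongr
      _ = x ^ p := key x hx
      _ ≤ _ := le_add_of_nonneg_right (by positivity)

theorem rpow_le_one_add_rpow {x p q : ℝ} (hx : 0 ≤ x) (hp : 0 ≤ p) (hpq : p ≤ q) :
    x ^ p ≤ 1 + x ^ q := by
  rcases le_total x 1 with h | h
  · exact (Real.rpow_le_one hx h hp).trans (le_add_of_nonneg_right (by positivity))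
  · exact (Real.rpow_le_rpow_of_exponent_le h hpq).trans (by linarith)

/-- A bound by a constant together with a power bound at large distances gives a power bound. -/
theorem le_mul_one_add_rpow {c C₀ C₁ s₀ s a : ℝ} (hs₀ : 1 ≤ s₀) (hs : 0 ≤ s) (ha : 0 ≤ a)
    (hC₀ : 0 ≤ C₀) (hC₁ : 0 ≤ C₁) (h₀ : c ≤ C₀) (h₁ : s₀ ≤ s → c ≤ C₁ * s ^ (-a)) :
    c ≤ (C₀ * (1 + s₀) ^ a + C₁ * 2 ^ a) * (1 + s) ^ (-a) := by
  rw [Real.rpow_neg (by positivity), ← div_eq_mul_inv, le_div_iff₀ (by positivity)]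
  rcases le_or_gt s₀ s with h | h
  · have hs' : 0 < s := by linarith
    have h2 : (1 + s) ^ a ≤ 2 ^ a * s ^ a := by
      rw [← Real.mul_rpow (by norm_num) hs]
      exact Real.rpow_le_rpow (by positivity) (by linarith) ha
    calc c * (1 + s) ^ a ≤ C₁ * s ^ (-a) * (1 + s) ^ a := by gcongr; exact h₁ h
      _ ≤ C₁ * s ^ (-a) * (2 ^ a * s ^ a) := by gcongr
      _ = C₁ * 2 ^ a := by rw [Real.rpow_neg hs]; field_simp
      _ ≤ _ := le_add_of_nonneg_left (by positivity)
  · calc c * (1 + s) ^ a ≤ C₀ * (1 + s₀) ^ a := by gcongr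
      _ ≤ _ := le_add_of_nonneg_right (by positivity)

/-- Geometric interpolation between two bounds. It is used to give up part of the decay in distance
in exchange for smallness in the truncation level. -/
theorem le_rpow_mul_rpow_of_le {c x y θ : ℝ} (hc : 0 ≤ c) (hx : c ≤ x) (hy : c ≤ y)
    (hθ₀ : 0 ≤ θ) (hθ₁ : θ ≤ 1) : c ≤ x ^ (1 - θ) * y ^ θ := by
  calc c = c ^ (1 - θ) * c ^ θ := by
        rw [← Real.rpow_add_of_nonneg hc (by linarith) hθ₀]; simp
    _ ≤ _ := mul_le_mul (Real.rpow_le_rpow hc hx (by linarith)) (Real.rpow_le_rpow hc hy hθ₀)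
        (Real.rpow_nonneg hc _) (Real.rpow_nonneg (hc.trans hx) _)

/-! ### Bounded Lipschitz functions. -/

/-- `f` is bounded by `A` and `L`-Lipschitz for the `ℓ¹` distance. -/
structure BddLip {ι : Type*} [Fintype ι] (f : (ι → ℝ) → ℝ) (A L : ℝ) : Prop where
  abs_le : ∀ x, |f x| ≤ A
  lip_nonneg : 0 ≤ L
  lip_le : ∀ x y, |f x - f y| ≤ L * ∑ k, |x k - y k|

namespace BddLip

variable {ι : Type*} [Fintype ι] {f g : (ι → ℝ) → ℝ} {A A' L L' : ℝ}

theorem nonneg (hf : BddLip f A L) : 0 ≤ A := (abs_nonneg _).trans (hf.abs_le 0)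

theorem mul (hf : BddLip f A L) (hg : BddLip g A' L') :
    BddLip (fun x => f x * g x) (A * A') (A * L' + A' * L) where
  abs_le x := by
    rw [abs_mul]
    exact mul_le_mul (hf.abs_le x) (hg.abs_le x) (abs_nonneg _) hf.nonneg
  lip_nonneg := add_nonneg (mul_nonneg hf.nonneg hg.lip_nonneg) (mul_nonneg hg.nonneg hf.lip_nonneg)
  lip_le x y := by
    have h : f x * g x - f y * g y = f x * (g x - g y) + (f x - f y) * g y := by ring
    calc |f x * g x - f y * g y| ≤ |f x| * |g x - g y| + |f x - f y| * |g y| := by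
          rw [h, ← abs_mul, ← abs_mul]; exact abs_add_le _ _
      _ ≤ A * (L' * ∑ k, |x k - y k|) + (L * ∑ k, |x k - y k|) * A' := by
          have h0 := hf.nonneg
          have h1 := (abs_nonneg _).trans (hf.lip_le x y)
          gcongr
          exacts [hf.abs_le x, hg.lip_le x y, hf.lip_le x y, hg.abs_le y]
      _ = _ := by ring

theorem continuous (hf : BddLip f A L) : Continuous f := by
  rw [continuous_iff_continuousAt]
  intro x
  rw [ContinuousAt, tendsto_iff_dist_tendsto_zero]
  have h : Tendsto (fun y => L * ∑ k, |y k - x k|) (𝓝 x) (𝓝 0) := by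
    have hc : Continuous (fun y : ι → ℝ => L * ∑ k, |y k - x k|) := by fun_prop
    simpa using hc.tendsto x
  exact squeeze_zero (fun _ => dist_nonneg) (fun y => by
    rw [Real.dist_eq]; exact hf.lip_le y x) h

theorem comp_eval {q : ℝ → ℝ} {B : ℝ} (hB : ∀ y, |q y| ≤ B) (hq : ∀ x y, |q x - q y| ≤ |x - y|)
    (k : ι) : BddLip (fun x : ι → ℝ => q (x k)) B 1 where
  abs_le x := hB _
  lip_nonneg := zero_le_one
  lip_le x y := by
    rw [one_mul]
    exact (hq _ _).trans
      (Finset.single_le_sum (f := fun k => |x k - y k|) (fun _ _ => abs_nonneg _)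
        (Finset.mem_univ k))

theorem comp_mul (hf : BddLip f A L) {r : ℝ} (hr : 0 ≤ r) :
    BddLip (fun x => f (fun k => r * x k)) A (L * r) where
  abs_le x := hf.abs_le _
  lip_nonneg := mul_nonneg hf.lip_nonneg hr
  lip_le x y := by
    refine (hf.lip_le _ _).trans (le_of_eq ?_)
    simp_rw [← mul_sub, abs_mul, abs_of_nonneg hr, ← Finset.mul_sum]
    ring

end BddLip

/-! ### Covariance bounds from moments. -/

section Moments

variable {Ω : Type*} [MeasurableSpace Ω] {μ : Measure Ω} [IsProbabilityMeasure μ]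

theorem abs_covariance_le {P Q : Ω → ℝ} (hP : MemLp P 2 μ) (hQ : MemLp Q 2 μ) :
    |cov[P, Q; μ]| ≤ ∫ ω, |P ω| * |Q ω| ∂μ + (∫ ω, |P ω| ∂μ) * ∫ ω, |Q ω| ∂μ := by
  rw [covariance_eq_sub hP hQ]
  refine (abs_sub _ _).trans ?_
  rw [abs_mul]
  have h1 : |∫ ω, (P * Q) ω ∂μ| ≤ ∫ ω, |P ω| * |Q ω| ∂μ := by
    refine (abs_integral_le_integral_abs).trans (le_of_eq ?_)
    simp [abs_mul]
  exact add_le_add h1 (mul_le_mul abs_integral_le_integral_abs abs_integral_le_integral_abs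
    (abs_nonneg _) (integral_nonneg fun _ => abs_nonneg _))

theorem abs_covariance_le_of_bdd {P Q : Ω → ℝ} {A A' : ℝ} (hP : Measurable P) (hQ : Measurable Q)
    (hA : ∀ ω, |P ω| ≤ A) (hA' : ∀ ω, |Q ω| ≤ A') : |cov[P, Q; μ]| ≤ 2 * (A * A') := by
  obtain ⟨ω₀⟩ : Nonempty Ω := nonempty_of_isProbabilityMeasure μ
  have hA0 : 0 ≤ A := (abs_nonneg _).trans (hA ω₀)
  have hP2 : MemLp P 2 μ := MemLp.of_bound hP.aestronglyMeasurable A (.of_forall hA)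
  have hQ2 : MemLp Q 2 μ := MemLp.of_bound hQ.aestronglyMeasurable A' (.of_forall hA')
  have key : ∀ {F : Ω → ℝ} {c : ℝ}, Integrable F μ → (∀ ω, F ω ≤ c) → ∫ ω, F ω ∂μ ≤ c :=
    fun hF h => by
      simpa using integral_mono hF (integrable_const _) h
  have h1 : ∫ ω, |P ω| * |Q ω| ∂μ ≤ A * A' := by
    refine key ?_ fun ω => mul_le_mul (hA ω) (hA' ω) (abs_nonneg _) hA0
    simpa [abs_mul] using (hP2.integrable_mul hQ2).abs
  have h2 : ∫ ω, |P ω| ∂μ ≤ A := key (hP2.integrable (by simp)).abs hA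
  have h3 : ∫ ω, |Q ω| ∂μ ≤ A' := key (hQ2.integrable (by simp)).abs hA'
  calc _ ≤ _ := abs_covariance_le hP2 hQ2
    _ ≤ A * A' + A * A' := add_le_add h1 (mul_le_mul h2 h3
        (integral_nonneg fun _ => abs_nonneg _) hA0)
    _ = _ := by ring

theorem memLp_two_of_integrable_rpow {Y : Ω → ℝ} {m : ℝ} (hm : 2 ≤ m) (hY : Measurable Y)
    (hint : Integrable (fun ω => |Y ω| ^ m) μ) : MemLp Y 2 μ := by
  rw [memLp_two_iff_integrable_sq hY.aestronglyMeasurable]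
  refine ((integrable_const 1).add hint).mono' (by fun_prop) (.of_forall fun ω => ?_)
  rw [Real.norm_eq_abs, abs_pow, ← Real.rpow_natCast]
  exact rpow_le_one_add_rpow (abs_nonneg _) (by norm_num) (by exact_mod_cast hm)

/-- The product is controlled by `|Y|^p |Y'| ≤ |Y|^(p+1) + |Y'|^(p+1)`, where `p + 1 ≤ m`. Two cases
are needed: `p = 1`, `u = 1` for Lipschitz images of the variables, and `p = m - 1`, `u =
T^(-(m-2))` for tails. -/
theorem abs_covariance_le_of_moment {Y Y' P Q : Ω → ℝ} {m K p u : ℝ}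
    (hint : Integrable (fun ω => |Y ω| ^ m) μ) (hK : ∫ ω, |Y ω| ^ m ∂μ ≤ K)
    (hint' : Integrable (fun ω => |Y' ω| ^ m) μ) (hK' : ∫ ω, |Y' ω| ^ m ∂μ ≤ K)
    (hP : MemLp P 2 μ) (hQ : MemLp Q 2 μ) (hu : 0 ≤ u) (hp : 1 ≤ p) (hpm : p ≤ m - 1)
    (hPY : ∀ ω, |P ω| ≤ u * |Y ω| ^ p) (hQY : ∀ ω, |Q ω| ≤ |Y' ω|) :
    |cov[P, Q; μ]| ≤ u * (2 + 2 * K + (1 + K) ^ 2) := by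
  have hK0 : 0 ≤ K := (integral_nonneg fun ω => by positivity).trans hK
  have h1 : ∫ ω, |P ω| * |Q ω| ∂μ ≤ u * (2 + 2 * K) := by
    have hY : Integrable (fun ω => 1 + |Y ω| ^ m) μ := (integrable_const 1).add hint
    have hY' : Integrable (fun ω => 1 + |Y' ω| ^ m) μ := (integrable_const 1).add hint'
    have hi : Integrable (fun ω => u * ((1 + |Y ω| ^ m) + (1 + |Y' ω| ^ m))) μ :=
      (hY.add hY').const_mul u
    calc ∫ ω, |P ω| * |Q ω| ∂μ ≤ ∫ ω, u * ((1 + |Y ω| ^ m) + (1 + |Y' ω| ^ m)) ∂μ := by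
          refine integral_mono ?_ hi fun ω => ?_
          · simpa [abs_mul] using (hP.integrable_mul hQ).abs
          · calc |P ω| * |Q ω| ≤ u * |Y ω| ^ p * |Y' ω| :=
                  mul_le_mul (hPY ω) (hQY ω) (abs_nonneg _) (by positivity)
              _ ≤ u * (|Y ω| ^ (p + 1) + |Y' ω| ^ (p + 1)) := by
                  rw [mul_assoc]
                  gcongr
                  simpa using rpow_mul_le_add (p := p + 1) (abs_nonneg (Y ω)) (abs_nonneg (Y' ω))
                    (by linarith)
              _ ≤ _ := by
                  gcongr <;>
                  exact rpow_le_one_add_rpow (abs_nonneg _) (by linarith) (by linarith)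
      _ = u * ((1 + ∫ ω, |Y ω| ^ m ∂μ) + (1 + ∫ ω, |Y' ω| ^ m ∂μ)) := by
          rw [integral_const_mul, integral_add hY hY', integral_add (integrable_const 1) hint,
            integral_add (integrable_const 1) hint']
          simp
      _ ≤ u * (2 + 2 * K) := mul_le_mul_of_nonneg_left (by linarith) hu
  have h2 : ∫ ω, |P ω| ∂μ ≤ u * (1 + K) := by
    calc ∫ ω, |P ω| ∂μ ≤ ∫ ω, u * (1 + |Y ω| ^ m) ∂μ := by
          refine integral_mono (hP.integrable (by simp)).abs
            (((integrable_const 1).add hint).const_mul u) fun ω => (hPY ω).trans ?_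
          gcongr
          exact rpow_le_one_add_rpow (abs_nonneg _) (by linarith) (by linarith)
      _ = u * (1 + ∫ ω, |Y ω| ^ m ∂μ) := by
          rw [integral_const_mul, integral_add (integrable_const 1) hint]; simp
      _ ≤ _ := by gcongr
  have h3 : ∫ ω, |Q ω| ∂μ ≤ 1 + K := by
    calc ∫ ω, |Q ω| ∂μ ≤ ∫ ω, (1 + |Y' ω| ^ m) ∂μ := by
          refine integral_mono (hQ.integrable (by simp)).abs
            ((integrable_const 1).add hint') fun ω => (hQY ω).trans ?_
          simpa using rpow_le_one_add_rpow (p := 1) (q := m) (abs_nonneg (Y' ω)) (by norm_num)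
            (by linarith)
      _ = 1 + ∫ ω, |Y' ω| ^ m ∂μ := by rw [integral_add (integrable_const 1) hint']; simp
      _ ≤ _ := by gcongr
  calc _ ≤ _ := abs_covariance_le hP hQ
    _ ≤ u * (2 + 2 * K) + u * (1 + K) * (1 + K) := add_le_add h1
        (mul_le_mul h2 h3 (integral_nonneg fun _ => abs_nonneg _) (by positivity))
    _ = _ := by ring

end Moments

/-! ### Decay of covariances in weakly dependent arrays. -/

/-- A `1`-Lipschitz function vanishing at the origin. -/
structure IsUnitLip (h : ℝ → ℝ) : Prop where
  map_zero : h 0 = 0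
  lip_le : ∀ x y, |h x - h y| ≤ |x - y|

namespace IsUnitLip

theorem abs_le {h : ℝ → ℝ} (hh : IsUnitLip h) (y : ℝ) : |h y| ≤ |y| := by
  simpa [hh.map_zero] using hh.lip_le y 0

theorem measurable {h : ℝ → ℝ} (hh : IsUnitLip h) : Measurable h := by
  have : LipschitzWith 1 h := LipschitzWith.of_dist_le_mul fun x y => by
    simpa [Real.dist_eq] using hh.lip_le x y
  exact this.continuous.measurable

theorem id : IsUnitLip fun y => y := ⟨rfl, fun _ _ => le_rfl⟩

theorem clip {T : ℝ} (hT : 0 ≤ T) : IsUnitLip (clip T) := ⟨clip_zero hT, abs_clip_sub_clip_le T⟩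

theorem sub_clip {T : ℝ} (hT : 0 ≤ T) : IsUnitLip fun y => y - WeakDep.clip T y :=
  ⟨by simp [clip_zero hT], abs_sub_sub_clip_le T⟩

end IsUnitLip

/-- A finite family of centred random variables with bounded `m`-th moments, whose covariances
between bounded Lipschitz functions of at most four of them decay at rate `s ^ (-α)`. -/
structure WeakArray {E Ω : Type*} [PseudoMetricSpace E] [MeasurableSpace Ω] (m K α κ s₀ : ℝ)
    (μ : Measure Ω) (Y : E → Ω → ℝ) (D : Finset E) : Prop where
  measurable : ∀ i ∈ D, Measurable (Y i)
  mean : ∀ i ∈ D, ∫ ω, Y i ω ∂μ = 0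
  integrable_rpow : ∀ i ∈ D, Integrable (fun ω => |Y i ω| ^ m) μ
  moment_le : ∀ i ∈ D, ∫ ω, |Y i ω| ^ m ∂μ ≤ K
  cov_le : ∀ U V : Finset E, U ⊆ D → V ⊆ D → U.card + V.card ≤ 4 → ∀ s : ℝ, s₀ ≤ s →
    (∀ i ∈ U, ∀ j ∈ V, s ≤ dist i j) → ∀ (f : (U → ℝ) → ℝ) (g : (V → ℝ) → ℝ) (A A' L L' : ℝ),
    BddLip f A L → BddLip g A' L' →
    |cov[fun ω => f (restr Y U ω), fun ω => g (restr Y V ω); μ]| ≤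
      κ * s ^ (-α) * (A * L' + A' * L)

namespace WeakArray

variable {E Ω : Type*} [PseudoMetricSpace E] [MeasurableSpace Ω] {m K α κ s₀ : ℝ}
  {μ : Measure Ω} [IsProbabilityMeasure μ] {Y : E → Ω → ℝ} {D : Finset E}

theorem memLp (hY : WeakArray m K α κ s₀ μ Y D) (hm : 2 ≤ m) {i : E} (hi : i ∈ D) {h : ℝ → ℝ}
    (hh : IsUnitLip h) : MemLp (fun ω => h (Y i ω)) 2 μ :=
  (memLp_two_of_integrable_rpow hm (hY.measurable i hi) (hY.integrable_rpow i hi)).mono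
    (hh.measurable.comp (hY.measurable i hi)).aestronglyMeasurable
    (.of_forall fun _ => hh.abs_le _)

theorem abs_cov_le_const (hY : WeakArray m K α κ s₀ μ Y D) (hm : 2 ≤ m) {i j : E} (hi : i ∈ D)
    (hj : j ∈ D) {h h' : ℝ → ℝ} (hh : IsUnitLip h) (hh' : IsUnitLip h') :
    |cov[fun ω => h (Y i ω), fun ω => h' (Y j ω); μ]| ≤ 2 + 2 * K + (1 + K) ^ 2 := by
  simpa using abs_covariance_le_of_moment (u := 1) (p := 1) (hY.integrable_rpow i hi)
    (hY.moment_le i hi) (hY.integrable_rpow j hj) (hY.moment_le j hj) (hY.memLp hm hi hh)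
    (hY.memLp hm hj hh') zero_le_one le_rfl (by linarith) (fun ω => by simpa using hh.abs_le _)
    (fun ω => hh'.abs_le _)

theorem abs_cov_le_of_tail (hY : WeakArray m K α κ s₀ μ Y D) (hm : 2 ≤ m) {i j : E} (hi : i ∈ D)
    (hj : j ∈ D) {T : ℝ} (hT : 0 < T) {P : Ω → ℝ} {h' : ℝ → ℝ} (hP : MemLp P 2 μ)
    (hPY : ∀ ω, |P ω| ≤ |Y i ω - clip T (Y i ω)|) (hh' : IsUnitLip h') :
    |cov[P, fun ω => h' (Y j ω); μ]| ≤
      T ^ (-(m - 2)) * (2 + 2 * K + (1 + K) ^ 2) :=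
  abs_covariance_le_of_moment (p := m - 1) (hY.integrable_rpow i hi)
    (hY.moment_le i hi) (hY.integrable_rpow j hj) (hY.moment_le j hj) hP
    (hY.memLp hm hj hh') (by positivity) (by linarith) le_rfl
    (fun ω => (hPY ω).trans (abs_sub_clip_le_rpow hT hm _)) (fun ω => hh'.abs_le _)

/-- Clip both arguments at `T`. The clipped pair is bounded by `T` and `1`-Lipschitz, so weak
dependence applies to it; the two remainders each contain a tail factor. The level `T` is left free,
to be optimised in terms of the distance. -/
theorem abs_cov_le_of_clip (hY : WeakArray m K α κ s₀ μ Y D) (hm : 2 ≤ m) {i j : E} (hi : i ∈ D)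
    (hj : j ∈ D) (hs : s₀ ≤ dist i j) {T : ℝ} (hT : 0 < T) {h h' : ℝ → ℝ} (hh : IsUnitLip h)
    (hh' : IsUnitLip h') :
    |cov[fun ω => h (Y i ω), fun ω => h' (Y j ω); μ]| ≤ κ * dist i j ^ (-α) * (2 * T) +
      2 * (T ^ (-(m - 2)) * (2 + 2 * K + (1 + K) ^ 2)) := by
  have comp : ∀ {h : ℝ → ℝ}, IsUnitLip h → IsUnitLip fun y => h (clip T y) := fun hh =>
    ⟨by rw [clip_zero hT.le, hh.map_zero],
      fun x y => (hh.lip_le _ _).trans (abs_clip_sub_clip_le T x y)⟩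
  set P := fun ω => h (Y i ω)
  set Q := fun ω => h' (Y j ω)
  set P' := fun ω => h (clip T (Y i ω))
  set Q' := fun ω => h' (clip T (Y j ω))
  have hP : MemLp P 2 μ := hY.memLp hm hi hh
  have hQ : MemLp Q 2 μ := hY.memLp hm hj hh'
  have hP' : MemLp P' 2 μ := hY.memLp hm hi (comp hh)
  have hQ' : MemLp Q' 2 μ := hY.memLp hm hj (comp hh')
  have e : cov[P, Q; μ] = cov[P', Q'; μ] + cov[P - P', Q; μ] + cov[Q - Q', P'; μ] := by
    rw [covariance_sub_left hP hP' hQ, covariance_sub_left hQ hQ' hP', covariance_comm Q P',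
      covariance_comm Q' P']
    ring
  have h1 : |cov[P', Q'; μ]| ≤ κ * dist i j ^ (-α) * (2 * T) := by
    have hb : ∀ {h : ℝ → ℝ}, IsUnitLip h → ∀ y, |h (clip T y)| ≤ T := fun hh y =>
      (hh.abs_le _).trans (abs_clip_le hT.le y)
    have := hY.cov_le {i} {j} (by simpa using hi) (by simpa using hj) (by simp) (dist i j) hs
      (by simp) _ _ T T 1 1
      (BddLip.comp_eval (hb hh) (comp hh).lip_le ⟨i, Finset.mem_singleton_self i⟩)
      (BddLip.comp_eval (hb hh') (comp hh').lip_le ⟨j, Finset.mem_singleton_self j⟩)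
    refine this.trans (le_of_eq (by ring))
  have h2 := hY.abs_cov_le_of_tail hm hi hj hT (hP.sub hP') (fun _ => hh.lip_le _ _) hh'
  have h3 := hY.abs_cov_le_of_tail hm hj hi hT (hQ.sub hQ') (fun _ => hh'.lip_le _ _) (comp hh)
  rw [e]
  refine (abs_add_three _ _ _).trans ?_
  linarith

/-- Decay of the covariances of Lipschitz functions, with the exponent lost by truncation. -/
theorem abs_cov_le (hY : WeakArray m K α κ s₀ μ Y D) (hm : 2 < m) (hα : 0 ≤ α) (hκ : 0 ≤ κ)
    (hs₀ : 1 ≤ s₀) {i j : E} (hi : i ∈ D) (hj : j ∈ D) {h h' : ℝ → ℝ} (hh : IsUnitLip h)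
    (hh' : IsUnitLip h') {C a : ℝ} (hC : C = 2 + 2 * K + (1 + K) ^ 2)
    (ha : a = α * (m - 2) / (m - 1)) :
    |cov[fun ω => h (Y i ω), fun ω => h' (Y j ω); μ]| ≤
      (C * (1 + s₀) ^ a + 2 * (κ + C) * 2 ^ a) * (1 + dist i j) ^ (-a) := by
  have hK0 : 0 ≤ K := (integral_nonneg fun ω => by positivity).trans (hY.moment_le i hi)
  have hC0 : 0 ≤ C := by rw [hC]; positivity
  have hm1 : 0 < m - 1 := by linarith
  have hm2 : 0 < m - 2 := by linarith
  refine le_mul_one_add_rpow hs₀ dist_nonneg (by rw [ha]; positivity) hC0 (by positivity)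
    (hC ▸ hY.abs_cov_le_const hm.le hi hj hh hh') fun hs => ?_
  have hs' : 0 < dist i j := by linarith
  -- This level makes `s^(-α) T` and `T^(-(m-2))` equal, both being `s^(-α(m-2)/(m-1))`.
  refine (hY.abs_cov_le_of_clip hm.le hi hj hs (T := dist i j ^ (α / (m - 1)))
    (by positivity) hh hh').trans (le_of_eq ?_)
  rw [← Real.rpow_mul hs'.le, ← hC, ha]
  have e1 : α / (m - 1) * -(m - 2) = -(α * (m - 2) / (m - 1)) := by ring
  have e2 : dist i j ^ (-α) * dist i j ^ (α / (m - 1)) =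
      dist i j ^ (-(α * (m - 2) / (m - 1))) := by
    rw [← Real.rpow_add hs']; congr 1; field_simp; ring
  rw [e1, ← e2]
  ring

/-- The covariances involving a tail part are small as well as decaying. -/
theorem abs_cov_tail_le (hY : WeakArray m K α κ s₀ μ Y D) (hm : 2 < m) (hα : 0 ≤ α) (hκ : 0 ≤ κ)
    (hs₀ : 1 ≤ s₀) {i j : E} (hi : i ∈ D) (hj : j ∈ D) {T : ℝ} (hT : 0 < T) {h' : ℝ → ℝ}
    (hh' : IsUnitLip h') {C a θ : ℝ} (hC : C = 2 + 2 * K + (1 + K) ^ 2)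
    (ha : a = α * (m - 2) / (m - 1)) (hθ₀ : 0 ≤ θ) (hθ₁ : θ ≤ 1) :
    |cov[fun ω => Y i ω - clip T (Y i ω), fun ω => h' (Y j ω); μ]| ≤
      (C * (1 + s₀) ^ a + 2 * (κ + C) * 2 ^ a) ^ (1 - θ) * C ^ θ * T ^ (-(θ * (m - 2))) *
        (1 + dist i j) ^ (-(a * (1 - θ))) := by
  have hK0 : 0 ≤ K := (integral_nonneg fun ω => by positivity).trans (hY.moment_le i hi)
  have hC0 : 0 ≤ C := by rw [hC]; positivity
  have h1 := hY.abs_cov_le hm hα hκ hs₀ hi hj (IsUnitLip.sub_clip hT.le) hh' hC ha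
  have h2 := hY.abs_cov_le_of_tail hm.le hi hj hT (hY.memLp hm.le hi (IsUnitLip.sub_clip hT.le))
    (fun _ => le_rfl) hh'
  rw [← hC] at h2
  refine (le_rpow_mul_rpow_of_le (abs_nonneg _) h1 h2 hθ₀ hθ₁).trans (le_of_eq ?_)
  rw [Real.mul_rpow (by positivity) (by positivity), Real.mul_rpow (by positivity) hC0,
    ← Real.rpow_mul (by positivity), ← Real.rpow_mul hT.le]
  rw [show -a * (1 - θ) = -(a * (1 - θ)) by ring, show -(m - 2) * θ = -(θ * (m - 2)) by ring]
  ring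

end WeakArray

/-! ### Products of truncated variables and the variance of the local quadratic form. -/

/-- The centred truncation of `Y i` at level `T`. -/
def trunc {E Ω : Type*} [MeasurableSpace Ω] (μ : Measure Ω) (T : ℝ) (Y : E → Ω → ℝ) (i : E)
    (ω : Ω) : ℝ := clip T (Y i ω) - ∫ ω', clip T (Y i ω') ∂μ

theorem measurable_clip {T : ℝ} : Measurable (clip T) := by
  unfold clip
  fun_prop

/-- Each of the three products runs over the edges of a tree on `i, j, k, l` rooted at `i`. Summing
the leaves first gives a factor `S` for the edge carrying `ψ` and a factor `G` for each edge
carrying `I`. The symmetry of `I` serves the third tree, where `k` hangs from `l`. -/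
theorem sum_sum_sum_sum_le {E : Type*} [PseudoMetricSpace E] {D : Finset E} {ψ I : E → E → ℝ}
    {S G : ℝ} (hψ : ∀ i j, 0 ≤ ψ i j) (hI : ∀ i j, 0 ≤ I i j) (hIs : ∀ i j, I i j = I j i)
    (hS : ∀ i ∈ D, ∑ j ∈ D, ψ i j ≤ S) (hG : ∀ i ∈ D, ∑ j ∈ D, I i j ≤ G) :
    ∑ i ∈ D, ∑ j ∈ D, ∑ k ∈ D, ∑ l ∈ D,
      (I i j * (ψ i k * I k l) + ψ i j * (I i k * I k l) + I i j * (ψ i l * I k l)) ≤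
      D.card * (3 * S * G ^ 2) := by
  rw [← nsmul_eq_mul, ← Finset.sum_const]
  refine Finset.sum_le_sum fun i hi => ?_
  have hS0 : 0 ≤ S := (Finset.sum_nonneg fun j _ => hψ i j).trans (hS i hi)
  have hG0 : 0 ≤ G := (Finset.sum_nonneg fun j _ => hI i j).trans (hG i hi)
  have bound : ∀ {x y : E → ℝ} {A B : ℝ}, (∀ j, 0 ≤ x j) → (∀ j ∈ D, y j ≤ B) →
      ∑ j ∈ D, x j ≤ A → 0 ≤ B → ∑ j ∈ D, x j * y j ≤ A * B := by
    intro x y A B hx hy hA hB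
    calc ∑ j ∈ D, x j * y j ≤ ∑ j ∈ D, x j * B :=
          Finset.sum_le_sum fun j hj => mul_le_mul_of_nonneg_left (hy j hj) (hx j)
      _ = (∑ j ∈ D, x j) * B := by rw [Finset.sum_mul]
      _ ≤ A * B := by gcongr
  have h1 : ∑ j ∈ D, ∑ k ∈ D, ∑ l ∈ D, I i j * (ψ i k * I k l) ≤ G * (S * G) := by
    simp_rw [← Finset.mul_sum]
    exact bound (hI i) (fun _ _ => bound (hψ i) hG (hS i hi) hG0) (hG i hi) (by positivity)
  have h2 : ∑ j ∈ D, ∑ k ∈ D, ∑ l ∈ D, ψ i j * (I i k * I k l) ≤ S * (G * G) := by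
    simp_rw [← Finset.mul_sum]
    exact bound (hψ i) (fun _ _ => bound (hI i) hG (hG i hi) hG0) (hS i hi) (by positivity)
  have h3 : ∑ j ∈ D, ∑ k ∈ D, ∑ l ∈ D, I i j * (ψ i l * I k l) ≤ G * (S * G) := by
    have : ∀ j ∈ D, ∑ k ∈ D, ∑ l ∈ D, I i j * (ψ i l * I k l) =
        I i j * ∑ l ∈ D, ψ i l * ∑ k ∈ D, I l k := fun j _ => by
      rw [Finset.sum_comm, Finset.mul_sum]
      refine Finset.sum_congr rfl fun l _ => ?_
      rw [Finset.mul_sum, Finset.mul_sum]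
      exact Finset.sum_congr rfl fun k _ => by rw [hIs k l]
    rw [Finset.sum_congr rfl this]
    exact bound (hI i) (fun _ _ => bound (hψ i) hG (hS i hi) hG0) (hG i hi) (by positivity)
  simp only [Finset.sum_add_distrib]
  nlinarith

section Truncation

variable {E Ω : Type*} [MeasurableSpace Ω] {μ : Measure Ω} [IsProbabilityMeasure μ] {Y : E → Ω → ℝ}

theorem abs_integral_clip_le {T : ℝ} (hT : 0 ≤ T) (i : E) :
    |∫ ω, clip T (Y i ω) ∂μ| ≤ T := by
  have h := norm_integral_le_of_norm_le_const (μ := μ) (f := fun ω => clip T (Y i ω))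
    (.of_forall fun ω => (Real.norm_eq_abs _).trans_le (abs_clip_le hT (Y i ω)))
  simpa using h

theorem abs_clip_sub_integral_le {T : ℝ} (hT : 0 ≤ T) (i : E) (y : ℝ) :
    |clip T y - ∫ ω, clip T (Y i ω) ∂μ| ≤ 2 * T := by
  refine (abs_sub _ _).trans ?_
  linarith [abs_clip_le hT y, abs_integral_clip_le (μ := μ) (Y := Y) hT i]

theorem abs_trunc_le {T : ℝ} (hT : 0 ≤ T) (i : E) (ω : Ω) : |trunc μ T Y i ω| ≤ 2 * T :=
  abs_clip_sub_integral_le hT i _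

theorem bddLip_trunc {ι : Type*} [Fintype ι] {T : ℝ} (hT : 0 ≤ T) (i : E) (e : ι) :
    BddLip (fun x : ι → ℝ => clip T (x e) - ∫ ω, clip T (Y i ω) ∂μ) (2 * T) 1 :=
  BddLip.comp_eval (q := fun y => clip T y - ∫ ω, clip T (Y i ω) ∂μ)
    (abs_clip_sub_integral_le hT i) (fun x y => by simpa using abs_clip_sub_clip_le T x y) e

end Truncation

namespace WeakArray

variable {E Ω : Type*} [PseudoMetricSpace E] [MeasurableSpace Ω] {m K α κ s₀ : ℝ}
  {μ : Measure Ω} {Y : E → Ω → ℝ} {D : Finset E}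

theorem measurable_trunc (hY : WeakArray m K α κ s₀ μ Y D) (T : ℝ) {i : E} (hi : i ∈ D) :
    Measurable (trunc μ T Y i) :=
  (measurable_clip.comp (hY.measurable i hi)).sub_const _

variable [IsProbabilityMeasure μ]

theorem memLp_trunc (hY : WeakArray m K α κ s₀ μ Y D) {T : ℝ} (hT : 0 ≤ T) {i : E} (hi : i ∈ D)
    (p : ℝ≥0∞) : MemLp (trunc μ T Y i) p μ :=
  MemLp.of_bound (hY.measurable_trunc T hi).aestronglyMeasurable (2 * T)
    (.of_forall fun ω => abs_trunc_le hT i ω)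

theorem memLp_trunc_mul (hY : WeakArray m K α κ s₀ μ Y D) {T : ℝ} (hT : 0 ≤ T) {i j : E}
    (hi : i ∈ D) (hj : j ∈ D) (p : ℝ≥0∞) :
    MemLp (fun ω => trunc μ T Y i ω * trunc μ T Y j ω) p μ :=
  MemLp.of_bound ((hY.measurable_trunc T hi).mul (hY.measurable_trunc T hj)).aestronglyMeasurable
    (2 * T * (2 * T)) (.of_forall fun ω => by
      rw [norm_mul]
      exact mul_le_mul (abs_trunc_le hT i ω) (abs_trunc_le hT j ω) (norm_nonneg _) (by positivity))

theorem integral_trunc (hY : WeakArray m K α κ s₀ μ Y D) {T : ℝ} (hT : 0 ≤ T) {i : E}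
    (hi : i ∈ D) : ∫ ω, trunc μ T Y i ω ∂μ = 0 := by
  have h : Integrable (fun ω => clip T (Y i ω)) μ :=
    Integrable.of_bound (measurable_clip.comp (hY.measurable i hi)).aestronglyMeasurable T
      (.of_forall fun ω => abs_clip_le hT _)
  simp only [trunc]
  rw [integral_sub h (integrable_const _)]
  simp

theorem abs_cov_trunc_le (hY : WeakArray m K α κ s₀ μ Y D) {T s : ℝ} (hT : 0 ≤ T) (hs : s₀ ≤ s)
    {i j : E} (hi : i ∈ D) (hj : j ∈ D) (hij : s ≤ dist i j) :
    |cov[trunc μ T Y i, trunc μ T Y j; μ]| ≤ κ * s ^ (-α) * (2 * (2 * T)) := by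
  have := hY.cov_le {i} {j} (by simpa using hi) (by simpa using hj) (by simp) s hs
    (by simpa using hij) _ _ _ _ _ _
    (bddLip_trunc (μ := μ) (Y := Y) hT i ⟨i, Finset.mem_singleton_self i⟩)
    (bddLip_trunc (μ := μ) (Y := Y) hT j ⟨j, Finset.mem_singleton_self j⟩)
  exact this.trans (le_of_eq (by ring))

/-- A truncated variable is bounded by `2T` and `1`-Lipschitz, so a product of two has bound
`(2T)^2` and Lipschitz constant `2(2T)`; two such products give the factor `4(2T)^3`. -/
theorem abs_cov_trunc_mul_le_of_pairs (hY : WeakArray m K α κ s₀ μ Y D) {T s : ℝ} (hT : 0 ≤ T)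
    (hs : s₀ ≤ s) {i j k l : E} (hi : i ∈ D) (hj : j ∈ D) (hk : k ∈ D) (hl : l ∈ D)
    (hik : s ≤ dist i k) (hil : s ≤ dist i l) (hjk : s ≤ dist j k) (hjl : s ≤ dist j l) :
    |cov[fun ω => trunc μ T Y i ω * trunc μ T Y j ω,
      fun ω => trunc μ T Y k ω * trunc μ T Y l ω; μ]| ≤ κ * s ^ (-α) * (4 * (2 * T) ^ 3) := by
  classical
  have mem : ∀ {a b : E}, a ∈ D → b ∈ D → ({a, b} : Finset E) ⊆ D := fun ha hb =>
    Finset.insert_subset ha (Finset.singleton_subset_iff.2 hb)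
  have := hY.cov_le {i, j} {k, l} (mem hi hj) (mem hk hl)
    (by linarith [Finset.card_le_two (a := i) (b := j), Finset.card_le_two (a := k) (b := l)]) s hs
    (by
      intro a ha b hb
      simp only [Finset.mem_insert, Finset.mem_singleton] at ha hb
      rcases ha with rfl | rfl <;> rcases hb with rfl | rfl <;> assumption) _ _ _ _ _ _
    ((bddLip_trunc (μ := μ) (Y := Y) hT i ⟨i, by simp⟩).mul
      (bddLip_trunc (μ := μ) (Y := Y) hT j ⟨j, by simp⟩))
    ((bddLip_trunc (μ := μ) (Y := Y) hT k ⟨k, by simp⟩).mul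
      (bddLip_trunc (μ := μ) (Y := Y) hT l ⟨l, by simp⟩))
  exact this.trans (le_of_eq (by ring))

theorem abs_cov_trunc_triple_le (hY : WeakArray m K α κ s₀ μ Y D) {T s : ℝ} (hT : 0 ≤ T)
    (hs : s₀ ≤ s) {i j k l : E} (hi : i ∈ D) (hj : j ∈ D) (hk : k ∈ D) (hl : l ∈ D)
    (hij : s ≤ dist i j) (hik : s ≤ dist i k) (hil : s ≤ dist i l) :
    |cov[trunc μ T Y i, fun ω => trunc μ T Y j ω * (trunc μ T Y k ω * trunc μ T Y l ω); μ]| ≤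
      κ * s ^ (-α) * (4 * (2 * T) ^ 3) := by
  classical
  have := hY.cov_le {i} {j, k, l} (by simpa using hi)
    (Finset.insert_subset hj (Finset.insert_subset hk (Finset.singleton_subset_iff.2 hl)))
    (by rw [Finset.card_singleton]; linarith [Finset.card_le_three (a := j) (b := k) (c := l)]) s hs
    (by
      intro a ha b hb
      simp only [Finset.mem_insert, Finset.mem_singleton] at ha hb
      subst ha
      rcases hb with rfl | rfl | rfl <;> assumption) _ _ _ _ _ _
    (bddLip_trunc (μ := μ) (Y := Y) hT i ⟨i, Finset.mem_singleton_self i⟩)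
    ((bddLip_trunc (μ := μ) (Y := Y) hT j ⟨j, by simp⟩).mul
      ((bddLip_trunc (μ := μ) (Y := Y) hT k ⟨k, by simp⟩).mul
        (bddLip_trunc (μ := μ) (Y := Y) hT l ⟨l, by simp⟩)))
  exact this.trans (le_of_eq (by ring))

/-- When `i` is far from the other three sites, centring makes both parts of the covariance small:
the fourth-order moment is the covariance of `Z i` with `Z j Z k Z l`, and `E[Z i Z j]` is itself a
covariance. They contribute `4` and `2` to the constant `6`. -/
theorem abs_cov_trunc_mul_le_of_isolated (hY : WeakArray m K α κ s₀ μ Y D) (hκ : 0 ≤ κ) {T s : ℝ}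
    (hT : 0 ≤ T) (hs₀ : 0 ≤ s₀) (hs : s₀ ≤ s) {i j k l : E} (hi : i ∈ D) (hj : j ∈ D) (hk : k ∈ D)
    (hl : l ∈ D) (hij : s ≤ dist i j) (hik : s ≤ dist i k) (hil : s ≤ dist i l) :
    |cov[fun ω => trunc μ T Y i ω * trunc μ T Y j ω,
      fun ω => trunc μ T Y k ω * trunc μ T Y l ω; μ]| ≤ κ * s ^ (-α) * (6 * (2 * T) ^ 3) := by
  have hs' : 0 ≤ s := hs₀.trans hs
  have h1 := hY.abs_cov_trunc_triple_le hT hs hi hj hk hl hij hik hil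
  have h2 := hY.abs_cov_trunc_le hT hs hi hj hij
  have hjkl : MemLp (fun ω => trunc μ T Y j ω * (trunc μ T Y k ω * trunc μ T Y l ω)) 2 μ :=
    (hY.memLp_trunc_mul hT hk hl ∞).mul (hY.memLp_trunc hT hj 2)
  rw [covariance_eq_sub (hY.memLp_trunc hT hi 2) hjkl, hY.integral_trunc hT hi, zero_mul,
    sub_zero] at h1
  rw [covariance_eq_sub (hY.memLp_trunc hT hi 2) (hY.memLp_trunc hT hj 2),
    hY.integral_trunc hT hi, zero_mul, sub_zero] at h2
  rw [covariance_eq_sub (hY.memLp_trunc_mul hT hi hj 2) (hY.memLp_trunc_mul hT hk hl 2)]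
  have h3 : |∫ ω, trunc μ T Y k ω * trunc μ T Y l ω ∂μ| ≤ (2 * T) ^ 2 := by
    have h := norm_integral_le_of_norm_le_const (μ := μ) (C := (2 * T) ^ 2)
      (f := fun ω => trunc μ T Y k ω * trunc μ T Y l ω) (.of_forall fun ω => by
        rw [norm_mul, sq]
        exact mul_le_mul (abs_trunc_le hT k ω) (abs_trunc_le hT l ω) (norm_nonneg _)
          (by positivity))
    simpa using h
  have e : ((fun ω => trunc μ T Y i ω * trunc μ T Y j ω) *
      fun ω => trunc μ T Y k ω * trunc μ T Y l ω) =
      trunc μ T Y i * fun ω => trunc μ T Y j ω * (trunc μ T Y k ω * trunc μ T Y l ω) := by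
    ext ω; simp only [Pi.mul_apply]; ring
  rw [e]
  refine (abs_sub _ _).trans ?_
  rw [abs_mul]
  have h4 := mul_le_mul h2 h3 (abs_nonneg _) (by positivity)
  refine (add_le_add h1 h4).trans (le_of_eq (by ring))

/-- There are two regimes. If `i` and `k` are more than `3r` apart, the two pairs are separated by a
fixed fraction of `dist i k`. Otherwise `i` is isolated at the smallest of its distances to `j`,
`k`, `l`, and the power of that minimum is at most the sum of the three powers. -/
theorem abs_cov_trunc_mul_le (hY : WeakArray m K α κ s₀ μ Y D) (hκ : 0 ≤ κ) (hα : 0 ≤ α)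
    (hs₀ : 1 ≤ s₀) {T r : ℝ} (hT : 0 ≤ T) {i j k l : E} (hi : i ∈ D) (hj : j ∈ D)
    (hk : k ∈ D) (hl : l ∈ D) (hij : dist i j ≤ r) (hkl : dist k l ≤ r) :
    |cov[fun ω => trunc μ T Y i ω * trunc μ T Y j ω,
      fun ω => trunc μ T Y k ω * trunc μ T Y l ω; μ]| ≤
      (2 * (2 * T) ^ 4 * (1 + s₀) ^ α + κ * (6 * (2 * T) ^ 3) * 2 ^ α) * 3 ^ α *
        ((1 + dist i k) ^ (-α) + (if dist i k ≤ 3 * r then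
          (1 + dist i j) ^ (-α) + (1 + dist i l) ^ (-α) else 0)) := by
  set c := |cov[fun ω => trunc μ T Y i ω * trunc μ T Y j ω,
      fun ω => trunc μ T Y k ω * trunc μ T Y l ω; μ]|
  set H := 2 * (2 * T) ^ 4 * (1 + s₀) ^ α + κ * (6 * (2 * T) ^ 3) * 2 ^ α
  have hH : 0 ≤ H := by positivity
  have h3 : (1 : ℝ) ≤ 3 ^ α := Real.one_le_rpow (by norm_num) hα
  have h0 : c ≤ 2 * (2 * T) ^ 4 := by
    have hb : ∀ a b : E, ∀ ω, |trunc μ T Y a ω * trunc μ T Y b ω| ≤ (2 * T) ^ 2 := by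
      intro a b ω
      rw [abs_mul, sq]
      exact mul_le_mul (abs_trunc_le hT a ω) (abs_trunc_le hT b ω) (abs_nonneg _)
          (by positivity)
    refine (abs_covariance_le_of_bdd ((hY.measurable_trunc T hi).mul (hY.measurable_trunc T hj))
      ((hY.measurable_trunc T hk).mul (hY.measurable_trunc T hl)) (hb i j) (hb k l)).trans
      (le_of_eq (by ring))
  have step : ∀ s, 0 ≤ s → (s₀ ≤ s → c ≤ κ * s ^ (-α) * (6 * (2 * T) ^ 3)) →
      c ≤ H * (1 + s) ^ (-α) := fun s hs h =>
    le_mul_one_add_rpow hs₀ hs hα (by positivity) (by positivity) h0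
      fun h' => (h h').trans (le_of_eq (by ring))
  split_ifs with hik
  · have hmin : ∀ s, 0 ≤ s → s ≤ dist i j → s ≤ dist i k → s ≤ dist i l →
        c ≤ H * (1 + s) ^ (-α) := fun s hs h1 h2 h3 => step s hs fun hs' =>
      hY.abs_cov_trunc_mul_le_of_isolated hκ hT (by linarith) hs' hi hj hk hl h1 h2 h3
    have hle : c ≤ H * ((1 + dist i k) ^ (-α) +
        ((1 + dist i j) ^ (-α) + (1 + dist i l) ^ (-α))) := by
      have p1 : 0 ≤ (1 + dist i k) ^ (-α) := by positivity
      have p2 : 0 ≤ (1 + dist i j) ^ (-α) := by positivity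
      have p3 : 0 ≤ (1 + dist i l) ^ (-α) := by positivity
      rcases le_total (dist i j) (dist i k) with h1 | h1 <;>
      rcases le_total (dist i j) (dist i l) with h2 | h2 <;>
      rcases le_total (dist i k) (dist i l) with h3 | h3
      all_goals first
        | exact (hmin _ dist_nonneg le_rfl (by linarith) (by linarith)).trans
            (mul_le_mul_of_nonneg_left (by linarith) hH)
        | exact (hmin _ dist_nonneg (by linarith) le_rfl (by linarith)).trans
            (mul_le_mul_of_nonneg_left (by linarith) hH)
        | exact (hmin _ dist_nonneg (by linarith) (by linarith) le_rfl).trans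
            (mul_le_mul_of_nonneg_left (by linarith) hH)
    refine hle.trans ?_
    gcongr
    exact le_mul_of_one_le_right hH h3
  · rw [not_le] at hik
    have d1 : dist i k ≤ dist i l + dist k l := by
      have := dist_triangle i l k; rwa [dist_comm l k] at this
    have d2 : dist i k ≤ dist i j + dist j k := dist_triangle i j k
    have d3 : dist j k ≤ dist j l + dist k l := by
      have := dist_triangle j l k; rwa [dist_comm l k] at this
    -- Both pairs have diameter at most `r < dist i k / 3`, so passing from `i` to `j` and from `k`
    -- to `l` loses at most two thirds of the distance.
    have hc : c ≤ H * (1 + dist i k / 3) ^ (-α) := by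
      refine step _ (by positivity) fun hs => ?_
      have hd : 0 ≤ dist i k := dist_nonneg
      refine (hY.abs_cov_trunc_mul_le_of_pairs hT hs hi hj hk hl (by linarith) (by linarith)
        (by linarith) (by linarith)).trans ?_
      gcongr
      norm_num
    rw [add_zero, mul_assoc]
    refine hc.trans (mul_le_mul_of_nonneg_left ?_ hH)
    have hd : 0 ≤ dist i k := dist_nonneg
    rw [Real.rpow_neg (by positivity), Real.rpow_neg (by positivity), ← div_eq_mul_inv,
      le_div_iff₀ (by positivity), ← div_eq_inv_mul, div_le_iff₀ (by positivity),
      ← Real.mul_rpow (by positivity) (by positivity)]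
    exact Real.rpow_le_rpow (by positivity) (by linarith) hα

/-- For fixed `T` the variance is of order `|D| G²`, with `G` bounding the cardinality of a ball of
radius `3r`. Against the normalisation `σ² ≥ c₀ |D|` the standard deviation is therefore negligible
as soon as `G = o(√|D|)`. -/
theorem variance_sum_trunc_mul_le (hY : WeakArray m K α κ s₀ μ Y D) (hκ : 0 ≤ κ) (hα : 0 ≤ α)
    (hs₀ : 1 ≤ s₀) {T r S G : ℝ} (hT : 0 ≤ T) (hr : 0 ≤ r)
    (hS : ∀ i ∈ D, ∑ j ∈ D, (1 + dist i j) ^ (-α) ≤ S)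
    (hG : ∀ i ∈ D, ((D.filter fun j => dist i j ≤ 3 * r).card : ℝ) ≤ G) :
    Var[fun ω => ∑ i ∈ D, trunc μ T Y i ω * ∑ j ∈ D with dist i j ≤ r, trunc μ T Y j ω; μ] ≤
      (2 * (2 * T) ^ 4 * (1 + s₀) ^ α + κ * (6 * (2 * T) ^ 3) * 2 ^ α) * 3 ^ α *
        (D.card * (3 * S * G ^ 2)) := by
  set H := (2 * (2 * T) ^ 4 * (1 + s₀) ^ α + κ * (6 * (2 * T) ^ 3) * 2 ^ α) * 3 ^ α
  have hH : 0 ≤ H := by positivity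
  set P := (D ×ˢ D).filter fun p : E × E => dist p.1 p.2 ≤ r with hP
  have hPD : ∀ p ∈ P, p.1 ∈ D ∧ p.2 ∈ D ∧ dist p.1 p.2 ≤ r := fun p hp => by
    rw [hP, Finset.mem_filter, Finset.mem_product] at hp
    exact ⟨hp.1.1, hp.1.2, hp.2⟩
  have e : (fun ω => ∑ i ∈ D, trunc μ T Y i ω * ∑ j ∈ D with dist i j ≤ r, trunc μ T Y j ω) =
      fun ω => ∑ p ∈ P, trunc μ T Y p.1 ω * trunc μ T Y p.2 ω := by
    ext ω
    rw [hP, Finset.sum_filter, Finset.sum_product]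
    refine Finset.sum_congr rfl fun i _ => ?_
    rw [Finset.mul_sum, Finset.sum_filter]
  have hmem : ∀ p ∈ P, MemLp (fun ω => trunc μ T Y p.1 ω * trunc μ T Y p.2 ω) 2 μ := fun p hp =>
    hY.memLp_trunc_mul hT (hPD p hp).1 (hPD p hp).2.1 2
  have hmeas : AEMeasurable (fun ω => ∑ p ∈ P, trunc μ T Y p.1 ω * trunc μ T Y p.2 ω) μ :=
    (memLp_finsetSum P hmem).aestronglyMeasurable.aemeasurable
  rw [e, ← covariance_self hmeas, covariance_fun_sum_fun_sum' hmem hmem]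
  set ψ : E → E → ℝ := fun i j => (1 + dist i j) ^ (-α) with hψ
  -- The radius `3 * r`, larger than needed for the pairs in `P`, lets one kernel also record that
  -- `i` and `k` are close.
  set I : E → E → ℝ := fun i j => if dist i j ≤ 3 * r then 1 else 0 with hI
  have hI1 : ∀ {i j}, dist i j ≤ 3 * r → I i j = 1 := fun h => by simp [hI, h]
  have hψ0 : ∀ i j, 0 ≤ ψ i j := fun i j => by positivity
  have hI0 : ∀ i j, 0 ≤ I i j := fun i j => by simp only [hI]; positivity
  have hterm : ∀ p ∈ P, ∀ q ∈ P, cov[fun ω => trunc μ T Y p.1 ω * trunc μ T Y p.2 ω,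
      fun ω => trunc μ T Y q.1 ω * trunc μ T Y q.2 ω; μ] ≤
      H * (I p.1 p.2 * (ψ p.1 q.1 * I q.1 q.2) + ψ p.1 p.2 * (I p.1 q.1 * I q.1 q.2) +
        I p.1 p.2 * (ψ p.1 q.2 * I q.1 q.2)) := by
    intro p hp q hq
    obtain ⟨hi, hj, hij⟩ := hPD p hp
    obtain ⟨hk, hl, hkl⟩ := hPD q hq
    refine (le_abs_self _).trans ((hY.abs_cov_trunc_mul_le hκ hα hs₀ hT hi hj hk hl hij
      hkl).trans ?_)
    rw [hI1 (hij.trans (by linarith)), hI1 (hkl.trans (by linarith))]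
    refine mul_le_mul_of_nonneg_left ?_ hH
    have p2 := hψ0 p.1 q.2
    split_ifs with h
    · rw [hI1 h]; simp only [hψ]; linarith
    · have : I p.1 q.1 = 0 := by simp [hI, h]
      rw [this]; simp only [hψ] at p2 ⊢; linarith
  calc _ ≤ ∑ p ∈ P, ∑ q ∈ P, H * (I p.1 p.2 * (ψ p.1 q.1 * I q.1 q.2) +
        ψ p.1 p.2 * (I p.1 q.1 * I q.1 q.2) + I p.1 p.2 * (ψ p.1 q.2 * I q.1 q.2)) :=
        Finset.sum_le_sum fun p hp => Finset.sum_le_sum fun q hq => hterm p hp q hq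
    _ ≤ ∑ p ∈ D ×ˢ D, ∑ q ∈ D ×ˢ D, H * (I p.1 p.2 * (ψ p.1 q.1 * I q.1 q.2) +
        ψ p.1 p.2 * (I p.1 q.1 * I q.1 q.2) + I p.1 p.2 * (ψ p.1 q.2 * I q.1 q.2)) := by
        have hnn : ∀ p q : E × E, 0 ≤ H * (I p.1 p.2 * (ψ p.1 q.1 * I q.1 q.2) +
            ψ p.1 p.2 * (I p.1 q.1 * I q.1 q.2) + I p.1 p.2 * (ψ p.1 q.2 * I q.1 q.2)) := by
          intro p q
          have := hψ0 p.1 q.1; have := hψ0 p.1 q.2; have := hψ0 p.1 p.2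
          have := hI0 p.1 p.2; have := hI0 p.1 q.1; have := hI0 q.1 q.2
          positivity
        refine (Finset.sum_le_sum fun p _ => Finset.sum_le_sum_of_subset_of_nonneg
          (Finset.filter_subset _ _) fun q _ _ => hnn p q).trans
          (Finset.sum_le_sum_of_subset_of_nonneg (Finset.filter_subset _ _)
            fun p _ _ => Finset.sum_nonneg fun q _ => hnn p q)
    _ = H * ∑ i ∈ D, ∑ j ∈ D, ∑ k ∈ D, ∑ l ∈ D,
        (I i j * (ψ i k * I k l) + ψ i j * (I i k * I k l) + I i j * (ψ i l * I k l)) := by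
        simp_rw [Finset.sum_product, Finset.mul_sum]
    _ ≤ _ := by
        refine mul_le_mul_of_nonneg_left (sum_sum_sum_sum_le hψ0 hI0 (fun i j => ?_) hS
          fun i hi => ?_) hH
        · simp only [hI, dist_comm]
        · simpa [hI] using hG i hi

end WeakArray

/-! ### The Stein equation for characteristic functions. -/

/-- For `|x| ≤ 1` this is the second-order Taylor bound. For `|x| > 1` the left side is at most
`2|x|`, whence the constant `2`. -/
theorem norm_one_sub_sub_exp_le (x : ℝ) :
    ‖1 - Complex.I * x - Complex.exp (-(Complex.I * x))‖ ≤ 2 * x ^ 2 := by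
  have hx : ‖-(Complex.I * (x : ℂ))‖ = |x| := by simp
  rcases le_or_gt |x| 1 with h | h
  · have := Complex.norm_exp_sub_one_sub_id_le (x := -(Complex.I * x)) (by rw [hx]; exact h)
    rw [hx, sq_abs] at this
    rw [← norm_neg]
    have e : -(1 - Complex.I * x - Complex.exp (-(Complex.I * x))) =
      Complex.exp (-(Complex.I * x)) - 1 - -(Complex.I * x) := by ring
    rw [e]
    nlinarith
  · have h1 : ‖Complex.exp (Complex.I * ((-x : ℝ) : ℂ)) - 1‖ ≤ ‖-x‖ :=
      Real.norm_exp_I_mul_ofReal_sub_one_le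
    have e : 1 - Complex.I * x - Complex.exp (-(Complex.I * x)) =
        -(Complex.exp (Complex.I * ((-x : ℝ) : ℂ)) - 1) + -(Complex.I * x) := by
      push_cast; ring_nf
    rw [e]
    refine (norm_add_le _ _).trans ?_
    rw [norm_neg, hx]
    rw [norm_neg, Real.norm_eq_abs] at h1
    nlinarith [sq_abs x]

section Stein

variable {Ω : Type*} [MeasurableSpace Ω] {μ : Measure Ω}

/-- The dependence bounds concern real test functions, so the exponential is split into its cosine
and sine. -/
theorem norm_integral_mul_exp_le {Z V : Ω → ℝ} (hZ : Integrable Z μ) (hV : Measurable V) :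
    ‖∫ ω, (Z ω : ℂ) * Complex.exp (Complex.I * (V ω : ℂ)) ∂μ‖ ≤
      |∫ ω, Real.cos (V ω) * Z ω ∂μ| + |∫ ω, Real.sin (V ω) * Z ω ∂μ| := by
  have h1 : Integrable (fun ω => Real.cos (V ω) * Z ω) μ :=
    hZ.bdd_mul (c := 1) (by fun_prop) (.of_forall fun ω => by simpa using Real.abs_cos_le_one _)
  have h2 : Integrable (fun ω => Real.sin (V ω) * Z ω) μ :=
    hZ.bdd_mul (c := 1) (by fun_prop) (.of_forall fun ω => by simpa using Real.abs_sin_le_one _)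
  have e : ∀ ω, (Z ω : ℂ) * Complex.exp (Complex.I * (V ω : ℂ)) =
      ((Real.cos (V ω) * Z ω : ℝ) : ℂ) + ((Real.sin (V ω) * Z ω : ℝ) : ℂ) * Complex.I := by
    intro ω
    rw [mul_comm Complex.I, Complex.exp_mul_I]
    push_cast
    ring
  simp_rw [e]
  rw [integral_add h1.ofReal (h2.ofReal.mul_const _), integral_mul_const, integral_complex_ofReal,
    integral_complex_ofReal]
  refine (norm_add_le _ _).trans ?_
  simp

variable [IsProbabilityMeasure μ]

theorem hasDerivAt_integral_exp {W : Ω → ℝ} (hW : Integrable W μ) (t : ℝ) :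
    HasDerivAt (fun t : ℝ => ∫ ω, Complex.exp (Complex.I * ((t * W ω : ℝ) : ℂ)) ∂μ)
      (∫ ω, Complex.I * W ω * Complex.exp (Complex.I * ((t * W ω : ℝ) : ℂ)) ∂μ) t := by
  have hWm := hW.aestronglyMeasurable
  have hmeas : ∀ t : ℝ, AEStronglyMeasurable
      (fun ω => Complex.exp (Complex.I * ((t * W ω : ℝ) : ℂ))) μ := fun t =>
    (by fun_prop : Continuous fun y : ℝ =>
      Complex.exp (Complex.I * ((t * y : ℝ) : ℂ))).comp_aestronglyMeasurable hWm
  refine (hasDerivAt_integral_of_dominated_loc_of_deriv_le (bound := fun ω => |W ω|)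
    (s := Set.univ) (F' := fun t ω => Complex.I * W ω *
      Complex.exp (Complex.I * ((t * W ω : ℝ) : ℂ))) univ_mem
    (.of_forall hmeas) ?_ ?_ ?_ hW.abs ?_).2
  · exact Integrable.of_bound (hmeas t) 1
      (.of_forall fun ω => by rw [Complex.norm_exp_I_mul_ofReal])
  · exact (by fun_prop : Continuous fun y : ℝ => Complex.I * (y : ℂ) *
      Complex.exp (Complex.I * ((t * y : ℝ) : ℂ))).comp_aestronglyMeasurable hWm
  · refine .of_forall fun ω s _ => ?_
    rw [norm_mul, Complex.norm_exp_I_mul_ofReal]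
    simp
  · refine .of_forall fun ω s _ => ?_
    have h1 : HasDerivAt (fun s : ℝ => ((s * W ω : ℝ) : ℂ)) (W ω) s := by
      simpa using ((hasDerivAt_id s).mul_const (W ω)).ofReal_comp
    have h2 := (h1.const_mul Complex.I).cexp
    rw [mul_comm] at h2
    exact h2

/-- If the characteristic function `φ` nearly solves `φ' + t φ = 0`, it is nearly Gaussian. -/
theorem norm_integral_exp_sub_le {W : Ω → ℝ} (hW : Integrable W μ) {t ε : ℝ}
    (h : ∀ s : ℝ, |s| ≤ |t| →
      ‖∫ ω, Complex.I * W ω * Complex.exp (Complex.I * ((s * W ω : ℝ) : ℂ)) ∂μ +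
        s * ∫ ω, Complex.exp (Complex.I * ((s * W ω : ℝ) : ℂ)) ∂μ‖ ≤ ε) :
    ‖∫ ω, Complex.exp (Complex.I * ((t * W ω : ℝ) : ℂ)) ∂μ - Complex.exp (-(t : ℂ) ^ 2 / 2)‖ ≤
      ε * |t| := by
  set φ : ℝ → ℂ := fun t => ∫ ω, Complex.exp (Complex.I * ((t * W ω : ℝ) : ℂ)) ∂μ with hφ
  set φ' : ℝ → ℂ := fun t => ∫ ω, Complex.I * W ω *
    Complex.exp (Complex.I * ((t * W ω : ℝ) : ℂ)) ∂μ with hφ'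
  -- With the integrating factor `exp(s²/2)` the derivative is the Stein defect times that factor.
  -- It is at most `ε exp(t²/2)` on `|s| ≤ |t|`, and multiplying back by `exp(-t²/2)` cancels the
  -- exponential.
  have hd : ∀ s : ℝ, HasDerivAt (fun s : ℝ => φ s * Complex.exp ((s : ℂ) ^ 2 / 2))
      ((φ' s + s * φ s) * Complex.exp ((s : ℂ) ^ 2 / 2)) s := by
    intro s
    have h1 : HasDerivAt (fun s : ℝ => (s : ℂ) ^ 2 / 2) (s : ℂ) s := by
      have := ((hasDerivAt_id s).ofReal_comp.pow 2).div_const 2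
      refine (this.congr_deriv ?_)
      simp
    refine ((hasDerivAt_integral_exp hW s).mul h1.cexp).congr_deriv ?_
    simp only [hφ, hφ']
    ring
  have hnorm : ∀ s : ℝ, ‖Complex.exp ((s : ℂ) ^ 2 / 2)‖ = Real.exp (s ^ 2 / 2) := fun s => by
    rw [show (s : ℂ) ^ 2 / 2 = ((s ^ 2 / 2 : ℝ) : ℂ) by push_cast; ring, ← Complex.ofReal_exp,
      Complex.norm_real, Real.norm_eq_abs, Real.abs_exp]
  have hε : 0 ≤ ε := (norm_nonneg _).trans (h t le_rfl)
  have hmv := Convex.norm_image_sub_le_of_norm_hasDerivWithin_le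
    (f := fun s : ℝ => φ s * Complex.exp ((s : ℂ) ^ 2 / 2)) (s := Set.Icc (-|t|) |t|)
    (C := ε * Real.exp (t ^ 2 / 2)) (fun s _ => (hd s).hasDerivWithinAt) (fun s hs => by
      have hs' : |s| ≤ |t| := abs_le.2 hs
      rw [norm_mul, hnorm]
      refine mul_le_mul (h s hs') (Real.exp_le_exp.2 ?_) (Real.exp_pos _).le hε
      have := sq_le_sq.2 hs'
      linarith) (convex_Icc _ _) (x := 0) (y := t) (by simp) (abs_le.1 le_rfl)
  have h0 : φ 0 = 1 := by simp [hφ]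
  have e : φ t - Complex.exp (-(t : ℂ) ^ 2 / 2) =
      (φ t * Complex.exp ((t : ℂ) ^ 2 / 2) - 1) * Complex.exp (-(t : ℂ) ^ 2 / 2) := by
    rw [sub_mul, one_mul, mul_assoc, ← Complex.exp_add]
    rw [show (t : ℂ) ^ 2 / 2 + -(t : ℂ) ^ 2 / 2 = 0 by ring, Complex.exp_zero, mul_one]
  have hmv' : ‖φ t * Complex.exp ((t : ℂ) ^ 2 / 2) - 1‖ ≤ ε * Real.exp (t ^ 2 / 2) * |t| := by
    simpa [h0] using hmv
  have hn : ‖Complex.exp (-(t : ℂ) ^ 2 / 2)‖ = Real.exp (-(t ^ 2 / 2)) := by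
    rw [show -(t : ℂ) ^ 2 / 2 = ((-(t ^ 2 / 2) : ℝ) : ℂ) by push_cast; ring, ← Complex.ofReal_exp,
      Complex.norm_real, Real.norm_eq_abs, Real.abs_exp]
  change ‖φ t - _‖ ≤ _
  rw [e, norm_mul, hn]
  calc _ ≤ ε * Real.exp (t ^ 2 / 2) * |t| * Real.exp (-(t ^ 2 / 2)) := by gcongr
    _ = ε * |t| * (Real.exp (t ^ 2 / 2) * Real.exp (-(t ^ 2 / 2))) := by ring
    _ = ε * |t| := by rw [← Real.exp_add, add_neg_cancel, Real.exp_zero, mul_one]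

theorem integral_abs_le_sqrt {Q : Ω → ℝ} (hQ : MemLp Q 2 μ) :
    ∫ ω, |Q ω| ∂μ ≤ √(∫ ω, Q ω ^ 2 ∂μ) := by
  refine Real.le_sqrt_of_sq_le ?_
  have h := variance_nonneg |Q| μ
  rw [variance_eq_sub hQ.abs] at h
  simpa using h

theorem integral_abs_sub_le {Q : Ω → ℝ} (hQ : MemLp Q 2 μ) (c : ℝ) :
    ∫ ω, |c - Q ω| ∂μ ≤ |c - ∫ ω, Q ω ∂μ| + √Var[Q; μ] := by
  have hc : MemLp (fun ω => Q ω - ∫ ω', Q ω' ∂μ) 2 μ := hQ.sub (memLp_const _)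
  have hi : Integrable (fun ω => |Q ω - ∫ ω', Q ω' ∂μ|) μ := (hc.integrable (by simp)).abs
  have h1 := integral_abs_le_sqrt hc
  rw [← variance_eq_integral hQ.aestronglyMeasurable.aemeasurable] at h1
  calc ∫ ω, |c - Q ω| ∂μ
      ≤ ∫ ω, (|c - ∫ ω', Q ω' ∂μ| + |Q ω - ∫ ω', Q ω' ∂μ|) ∂μ := by
        refine integral_mono ((integrable_const c).sub (hQ.integrable (by simp))).abs
          ((integrable_const _).add hi) fun ω => ?_
        have := abs_sub (c - ∫ ω', Q ω' ∂μ) (Q ω - ∫ ω', Q ω' ∂μ)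
        simpa using this
    _ = |c - ∫ ω', Q ω' ∂μ| + ∫ ω, |Q ω - ∫ ω', Q ω' ∂μ| ∂μ := by
        rw [integral_add (integrable_const _) hi]; simp
    _ ≤ _ := by gcongr

/-- The error in the Stein equation for a normalised sum of bounded random variables, where `N i`
is the set of indices on which `Z i` may depend strongly. -/
theorem norm_stein_le {E : Type*} {D : Finset E} {N : E → Finset E} (hN : ∀ i ∈ D, N i ⊆ D)
    {Z : E → Ω → ℝ} {B σ : ℝ} (hZ : ∀ i ∈ D, Measurable (Z i)) (hB0 : 0 ≤ B)
    (hB : ∀ i ∈ D, ∀ ω, |Z i ω| ≤ B) (hσ : 0 < σ) {W : Ω → ℝ}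
    (hW : ∀ ω, W ω = σ⁻¹ * ∑ i ∈ D, Z i ω) {R : E → Ω → ℝ}
    (hR : ∀ i ∈ D, ∀ ω, R i ω = ∑ j ∈ D, Z j ω - ∑ j ∈ N i, Z j ω) (t : ℝ) :
    ‖∫ ω, Complex.I * W ω * Complex.exp (Complex.I * ((t * W ω : ℝ) : ℂ)) ∂μ +
        t * ∫ ω, Complex.exp (Complex.I * ((t * W ω : ℝ) : ℂ)) ∂μ‖ ≤
      σ⁻¹ * ∑ i ∈ D, ‖∫ ω, (Z i ω : ℂ) * Complex.exp (Complex.I *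
        ((t * σ⁻¹ * R i ω : ℝ) : ℂ)) ∂μ‖ +
      |t| * ∫ ω, |1 - (σ ^ 2)⁻¹ * ∑ i ∈ D, Z i ω * ∑ j ∈ N i, Z j ω| ∂μ +
      2 * (σ ^ 3)⁻¹ * B * t ^ 2 * ∑ i ∈ D, ∫ ω, (∑ j ∈ N i, Z j ω) ^ 2 ∂μ := by
  set T : E → Ω → ℝ := fun i ω => ∑ j ∈ N i, Z j ω with hT
  have hZb : ∀ i ∈ D, MemLp (Z i) ∞ μ := fun i hi =>
    MemLp.of_bound (hZ i hi).aestronglyMeasurable B (.of_forall (hB i hi))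
  have hTb : ∀ i ∈ D, MemLp (T i) ∞ μ := fun i hi =>
    memLp_finsetSum _ fun j hj => hZb j (hN i hi hj)
  have hSb : MemLp (fun ω => ∑ i ∈ D, Z i ω) ∞ μ := memLp_finsetSum _ hZb
  have hWb : MemLp W ∞ μ := by
    rw [show W = fun ω => σ⁻¹ * ∑ i ∈ D, Z i ω from funext hW]
    exact hSb.const_mul _
  have hZTb : ∀ i ∈ D, MemLp (fun ω => Z i ω * T i ω) ∞ μ := fun i hi =>
    (hTb i hi).mul (hZb i hi)
  have hQb : MemLp (fun ω => 1 - (σ ^ 2)⁻¹ * ∑ i ∈ D, Z i ω * T i ω) ∞ μ :=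
    (memLp_const 1).sub ((memLp_finsetSum _ hZTb).const_mul _)
  have hRb : ∀ i ∈ D, MemLp (R i) ∞ μ := fun i hi => by
    rw [show R i = fun ω => ∑ j ∈ D, Z j ω - ∑ j ∈ N i, Z j ω from funext (hR i hi)]
    exact hSb.sub (hTb i hi)
  have hexp : ∀ {V : Ω → ℝ}, MemLp V ∞ μ →
      AEStronglyMeasurable (fun ω => Complex.exp (Complex.I * (V ω : ℂ))) μ := fun hV =>
    (by fun_prop : Continuous fun y : ℝ =>
      Complex.exp (Complex.I * (y : ℂ))).comp_aestronglyMeasurable hV.aestronglyMeasurable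
  have hint : ∀ {V U : Ω → ℝ}, MemLp V ∞ μ → MemLp U ∞ μ →
      Integrable (fun ω => (U ω : ℂ) * Complex.exp (Complex.I * (V ω : ℂ))) μ := fun hV hU =>
    (hU.integrable (by simp)).ofReal.mul_bdd (c := 1) (hexp hV)
      (.of_forall fun ω => by rw [Complex.norm_exp_I_mul_ofReal])
  have htW : MemLp (fun ω => t * W ω) ∞ μ := hWb.const_mul t
  have htR : ∀ i ∈ D, MemLp (fun ω => t * σ⁻¹ * R i ω) ∞ μ := fun i hi => (hRb i hi).const_mul _
  set e : Ω → ℂ := fun ω => Complex.exp (Complex.I * ((t * W ω : ℝ) : ℂ)) with he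
  set eR : E → Ω → ℂ := fun i ω => Complex.exp (Complex.I * ((t * σ⁻¹ * R i ω : ℝ) : ℂ)) with heR
  set q : Ω → ℝ := fun ω => 1 - (σ ^ 2)⁻¹ * ∑ i ∈ D, Z i ω * T i ω with hq
  set x : E → Ω → ℝ := fun i ω => t * σ⁻¹ * T i ω with hx
  set G : Ω → ℂ := fun ω => Complex.I * (σ : ℂ)⁻¹ * ∑ i ∈ D, Z i ω * (e ω *
    (1 - Complex.I * (x i ω : ℂ) - Complex.exp (-(Complex.I * (x i ω : ℂ))))) with hG
  have hσ' : (σ : ℂ) ≠ 0 := by exact_mod_cast hσ.ne'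
  -- Pointwise, `e = eR i + i x e + e (1 - i x - exp(-i x))` with `x = t σ⁻¹ T i`. Weighted by `Z i`
  -- and summed, the linear terms give `-t σ⁻² ∑ Z i T i e`, which combines with `t e` into `t q e`;
  -- the Taylor remainders make up `G`.
  have hId : ∀ ω, Complex.I * W ω * e ω + t * e ω =
      Complex.I * (σ : ℂ)⁻¹ * ∑ i ∈ D, Z i ω * eR i ω + t * (q ω * e ω) + G ω := by
    intro ω
    have h1 : ∀ i ∈ D, e ω * Complex.exp (-(Complex.I * (x i ω : ℂ))) = eR i ω := by
      intro i hi
      simp only [he, heR, hx]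
      rw [← Complex.exp_add, hR i hi, hW]
      congr 1
      simp only [hT]
      push_cast
      ring
    have h2 : G ω = Complex.I * (σ : ℂ)⁻¹ * ∑ i ∈ D, ((Z i ω : ℂ) * e ω -
        Complex.I * t * (σ : ℂ)⁻¹ * e ω * (Z i ω * T i ω) - Z i ω * eR i ω) := by
      simp only [hG]
      congr 1
      refine Finset.sum_congr rfl fun i hi => ?_
      rw [← h1 i hi]
      simp only [hx]
      push_cast
      ring
    rw [h2]
    simp only [Finset.sum_sub_distrib, ← Finset.mul_sum, ← Finset.sum_mul]
    have h3 : (q ω : ℂ) = 1 - ((σ : ℂ) ^ 2)⁻¹ * ∑ i ∈ D, (Z i ω : ℂ) * T i ω := by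
      simp only [hq]; push_cast; rfl
    rw [h3, hW ω]
    push_cast
    field_simp
    linear_combination (e ω * t * ∑ i ∈ D, (Z i ω : ℂ) * (T i ω : ℂ)) * Complex.I_sq
  have hi1 : Integrable (fun ω => Complex.I * W ω * e ω) μ := by
    simp_rw [mul_assoc]
    exact (hint htW hWb).const_mul _
  have hi2 : Integrable (fun ω => (t : ℂ) * e ω) μ := by
    refine ((hint htW (memLp_const (1 : ℝ))).congr (.of_forall fun ω => ?_)).const_mul _
    simp [he]
  have hi3 : ∀ i ∈ D, Integrable (fun ω => (Z i ω : ℂ) * eR i ω) μ := fun i hi =>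
    hint (htR i hi) (hZb i hi)
  have hi4 : Integrable (fun ω => (t : ℂ) * (q ω * e ω)) μ := (hint htW hQb).const_mul _
  have hi5 : Integrable (fun ω => Complex.I * (σ : ℂ)⁻¹ * ∑ i ∈ D, Z i ω * eR i ω) μ :=
    (integrable_finsetSum _ hi3).const_mul _
  have hi6 : Integrable G μ := by
    have := (hi1.add hi2).sub (hi5.add hi4)
    refine this.congr (.of_forall fun ω => ?_)
    simp only [Pi.sub_apply, Pi.add_apply]
    rw [hId ω]
    ring
  have hsq : ∀ i ∈ D, Integrable (fun ω => T i ω ^ 2) μ := fun i hi => by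
    have := ((hTb i hi).mono_exponent (p := 2) le_top).integrable_sq
    exact this
  have hGle : ∀ ω, ‖G ω‖ ≤ 2 * (σ ^ 3)⁻¹ * B * t ^ 2 * ∑ i ∈ D, T i ω ^ 2 := by
    intro ω
    simp only [hG]
    rw [norm_mul, norm_mul, Complex.norm_I, one_mul, norm_inv, Complex.norm_real, Real.norm_eq_abs,
      abs_of_pos hσ]
    have : ‖∑ i ∈ D, (Z i ω : ℂ) * (e ω *
        (1 - Complex.I * (x i ω : ℂ) - Complex.exp (-(Complex.I * (x i ω : ℂ)))))‖ ≤
        ∑ i ∈ D, B * (2 * (t * σ⁻¹ * T i ω) ^ 2) := by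
      refine norm_sum_le_of_le _ fun i hi => ?_
      rw [norm_mul, norm_mul, Complex.norm_exp_I_mul_ofReal, one_mul, Complex.norm_real]
      exact mul_le_mul (hB i hi ω) (norm_one_sub_sub_exp_le _) (norm_nonneg _) hB0
    calc _ ≤ σ⁻¹ * ∑ i ∈ D, B * (2 * (t * σ⁻¹ * T i ω) ^ 2) := by gcongr
      _ = _ := by
        rw [Finset.mul_sum, Finset.mul_sum]
        refine Finset.sum_congr rfl fun i _ => ?_
        field_simp
  have hi7 : Integrable (fun ω => Complex.I * (σ : ℂ)⁻¹ * ∑ i ∈ D, Z i ω * eR i ω +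
      t * (q ω * e ω)) μ := hi5.add hi4
  rw [← integral_const_mul, ← integral_add hi1 hi2]
  simp_rw [hId]
  rw [integral_add hi7 hi6, integral_add hi5 hi4, integral_const_mul,
    integral_finsetSum _ hi3, integral_const_mul]
  refine (norm_add₃_le).trans (add_le_add_three ?_ ?_ ?_)
  · rw [norm_mul, norm_mul, Complex.norm_I, one_mul, norm_inv, Complex.norm_real, Real.norm_eq_abs,
      abs_of_pos hσ]
    gcongr
    exact norm_sum_le _ _
  · rw [norm_mul, Complex.norm_real, Real.norm_eq_abs]
    gcongr
    refine (norm_integral_le_integral_norm _).trans (le_of_eq ?_)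
    congr 1
    ext ω
    rw [norm_mul, Complex.norm_exp_I_mul_ofReal, mul_one, Complex.norm_real, Real.norm_eq_abs]
  · refine (norm_integral_le_integral_norm _).trans ?_
    rw [← integral_finsetSum _ hsq, ← integral_const_mul]
    exact integral_mono hi6.norm ((integrable_finsetSum _ hsq).const_mul _) hGle

end Stein

/-! ### The Stein error for weakly dependent arrays. -/

theorem sum_filter_not_le_rpow {E : Type*} [PseudoMetricSpace E] {F : Finset E} {i : E}
    {a b S r : ℝ} (hba : b ≤ a) (hS : ∑ j ∈ F, (1 + dist i j) ^ (-b) ≤ S) (hr : 0 ≤ r) :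
    ∑ j ∈ F with ¬ dist i j ≤ r, (1 + dist i j) ^ (-a) ≤ S * (1 + r) ^ (-(a - b)) := by
  have h : ∀ j ∈ F.filter (fun j => ¬ dist i j ≤ r), (1 + dist i j) ^ (-a) ≤
      (1 + dist i j) ^ (-b) * (1 + r) ^ (-(a - b)) := fun j hj => by
    rw [show -a = -b + -(a - b) by ring, Real.rpow_add (by positivity)]
    gcongr 1
    exact Real.rpow_le_rpow_of_nonpos (by positivity)
      (by linarith [not_le.1 (Finset.mem_filter.1 hj).2]) (by linarith)
  refine (Finset.sum_le_sum h).trans ?_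
  rw [← Finset.sum_mul]
  gcongr
  exact (Finset.sum_le_sum_of_subset_of_nonneg (Finset.filter_subset _ F)
    fun j _ _ => by positivity).trans hS

/-- Covariances between a bounded, slowly varying function of the variables at distance at least
`r` from `i` and the truncation of `Y i` are at most `e`. -/
def LongRange {E Ω : Type*} [PseudoMetricSpace E] [MeasurableSpace Ω] (μ : Measure Ω)
    (Y : E → Ω → ℝ) (D : Finset E) (T r ℓ e : ℝ) : Prop :=
  ∀ i ∈ D, ∀ U ⊆ D, (∀ j ∈ U, r ≤ dist j i) → ∀ f : (U → ℝ) → ℝ, BddLip f 1 ℓ →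
    |cov[fun ω => f (restr Y U ω), fun ω => clip T (Y i ω); μ]| ≤ e

namespace WeakArray

variable {E Ω : Type*} [PseudoMetricSpace E] [MeasurableSpace Ω] {m K α κ s₀ : ℝ}
  {μ : Measure Ω} [IsProbabilityMeasure μ] {Y : E → Ω → ℝ} {D : Finset E}

theorem memLp_self (hY : WeakArray m K α κ s₀ μ Y D) (hm : 2 ≤ m) {i : E} (hi : i ∈ D) :
    MemLp (Y i) 2 μ := hY.memLp hm hi IsUnitLip.id

theorem cov_trunc_eq (hY : WeakArray m K α κ s₀ μ Y D) (hm : 2 ≤ m) {T : ℝ} (hT : 0 ≤ T)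
    {i : E} (hi : i ∈ D) {Q : Ω → ℝ} :
    cov[trunc μ T Y i, Q; μ] = cov[fun ω => clip T (Y i ω), Q; μ] :=
  covariance_sub_const_left ((hY.memLp hm hi (IsUnitLip.clip hT)).integrable (by simp)) _

theorem cov_trunc_trunc_eq (hY : WeakArray m K α κ s₀ μ Y D) (hm : 2 ≤ m) {T : ℝ} (hT : 0 ≤ T)
    {i j : E} (hi : i ∈ D) (hj : j ∈ D) :
    cov[trunc μ T Y i, trunc μ T Y j; μ] =
      cov[fun ω => clip T (Y i ω), fun ω => clip T (Y j ω); μ] := by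
  rw [hY.cov_trunc_eq hm hT hi, covariance_comm, hY.cov_trunc_eq hm hT hj, covariance_comm]

theorem integral_trunc_mul (hY : WeakArray m K α κ s₀ μ Y D) {T : ℝ} (hT : 0 ≤ T)
    {i j : E} (hi : i ∈ D) (hj : j ∈ D) :
    ∫ ω, trunc μ T Y i ω * trunc μ T Y j ω ∂μ = cov[trunc μ T Y i, trunc μ T Y j; μ] := by
  rw [covariance_eq_sub (hY.memLp_trunc hT hi 2) (hY.memLp_trunc hT hj 2), hY.integral_trunc hT hi,
    zero_mul, sub_zero]
  rfl

theorem sum_abs_le {a C S : ℝ} {c : E → E → ℝ} (hC : 0 ≤ C)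
    (hc : ∀ i ∈ D, ∀ j ∈ D, |c i j| ≤ C * (1 + dist i j) ^ (-a))
    (hS : ∀ i ∈ D, ∑ j ∈ D, (1 + dist i j) ^ (-a) ≤ S) {N : Finset E} (hN : N ⊆ D) :
    |∑ i ∈ N, ∑ j ∈ D, c i j| ≤ N.card * (C * S) := by
  rw [← nsmul_eq_mul, ← Finset.sum_const]
  refine (Finset.abs_sum_le_sum_abs _ _).trans (Finset.sum_le_sum fun i hi => ?_)
  refine (Finset.abs_sum_le_sum_abs _ _).trans ?_
  calc _ ≤ ∑ j ∈ D, C * (1 + dist i j) ^ (-a) := Finset.sum_le_sum fun j hj => hc i (hN hi) j hj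
    _ ≤ C * S := by
      rw [← Finset.mul_sum]; exact mul_le_mul_of_nonneg_left (hS i (hN hi)) hC

theorem integral_sum_trunc_sq_le (hY : WeakArray m K α κ s₀ μ Y D) {a C S T : ℝ}
    (hT : 0 ≤ T) (hC : 0 ≤ C)
    (hc : ∀ i ∈ D, ∀ j ∈ D, |cov[trunc μ T Y i, trunc μ T Y j; μ]| ≤ C * (1 + dist i j) ^ (-a))
    (hS : ∀ i ∈ D, ∑ j ∈ D, (1 + dist i j) ^ (-a) ≤ S) {N : Finset E} (hN : N ⊆ D) :
    ∫ ω, (∑ j ∈ N, trunc μ T Y j ω) ^ 2 ∂μ ≤ N.card * (C * S) := by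
  have hi : ∀ i ∈ N, ∀ j ∈ N, Integrable (fun ω => trunc μ T Y i ω * trunc μ T Y j ω) μ :=
    fun i hi j hj => (hY.memLp_trunc_mul hT (hN hi) (hN hj) 1).integrable le_rfl
  calc ∫ ω, (∑ j ∈ N, trunc μ T Y j ω) ^ 2 ∂μ
      = ∑ i ∈ N, ∑ j ∈ N, ∫ ω, trunc μ T Y i ω * trunc μ T Y j ω ∂μ := by
        simp_rw [sq, Finset.sum_mul_sum]
        rw [integral_finsetSum _ fun i h => integrable_finsetSum _ (hi i h)]
        exact Finset.sum_congr rfl fun i h => integral_finsetSum _ (hi i h)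
    _ ≤ |∑ i ∈ N, ∑ j ∈ N, ∫ ω, trunc μ T Y i ω * trunc μ T Y j ω ∂μ| := le_abs_self _
    _ ≤ _ := by
        refine sum_abs_le (a := a) hC (fun i hi j hj => ?_) (fun i hi => ?_) subset_rfl
        · rw [hY.integral_trunc_mul hT (hN hi) (hN hj)]
          exact hc i (hN hi) j (hN hj)
        · exact (Finset.sum_le_sum_of_subset_of_nonneg hN fun j _ _ => by positivity).trans
            (hS i (hN hi))

/-- The local variance `∑ᵢ E[Zᵢ Sᵢ]` of the truncated variables is close to the variance of the
full sum. -/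
theorem abs_variance_sub_local_le (hY : WeakArray m K α κ s₀ μ Y D) (hm : 2 ≤ m)
    {a b C₁ C₂ S T r : ℝ} (hT : 0 ≤ T) (hr : 0 ≤ r) (hba : b ≤ a) (hC₁ : 0 ≤ C₁) (hC₂ : 0 ≤ C₂)
    (hc : ∀ i ∈ D, ∀ j ∈ D, |cov[trunc μ T Y i, trunc μ T Y j; μ]| ≤ C₁ * (1 + dist i j) ^ (-a))
    (htail : ∀ i ∈ D, ∀ j ∈ D, ∀ h' : ℝ → ℝ, IsUnitLip h' →
      |cov[fun ω => Y i ω - clip T (Y i ω), fun ω => h' (Y j ω); μ]| ≤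
        C₂ * (1 + dist i j) ^ (-b))
    (hS : ∀ i ∈ D, ∑ j ∈ D, (1 + dist i j) ^ (-b) ≤ S) :
    |Var[fun ω => ∑ i ∈ D, Y i ω; μ] -
        ∫ ω, ∑ i ∈ D, trunc μ T Y i ω * ∑ j ∈ D with dist i j ≤ r, trunc μ T Y j ω ∂μ| ≤
      D.card * (2 * C₂ * S + C₁ * (S * (1 + r) ^ (-(a - b)))) := by
  have hmem : ∀ i ∈ D, MemLp (Y i) 2 μ := fun i hi => hY.memLp_self hm hi
  have hi : ∀ i ∈ D, ∀ j ∈ D, Integrable (fun ω => trunc μ T Y i ω * trunc μ T Y j ω) μ :=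
    fun i hi j hj => (hY.memLp_trunc_mul hT hi hj 1).integrable le_rfl
  have h1 : Var[fun ω => ∑ i ∈ D, Y i ω; μ] = ∑ i ∈ D, ∑ j ∈ D, cov[Y i, Y j; μ] := by
    rw [← covariance_self (memLp_finsetSum D hmem).aestronglyMeasurable.aemeasurable,
      covariance_fun_sum_fun_sum' hmem hmem]
  have h2 : ∫ ω, ∑ i ∈ D, trunc μ T Y i ω * ∑ j ∈ D with dist i j ≤ r, trunc μ T Y j ω ∂μ =
      ∑ i ∈ D, ∑ j ∈ D with dist i j ≤ r, cov[trunc μ T Y i, trunc μ T Y j; μ] := by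
    simp_rw [Finset.mul_sum]
    rw [integral_finsetSum _ fun i h => integrable_finsetSum _ fun j hj =>
      hi i h j (Finset.mem_filter.1 hj).1]
    refine Finset.sum_congr rfl fun i h => ?_
    rw [integral_finsetSum _ fun j hj => hi i h j (Finset.mem_filter.1 hj).1]
    exact Finset.sum_congr rfl fun j hj =>
      hY.integral_trunc_mul hT h (Finset.mem_filter.1 hj).1
  have h3 : ∀ i ∈ D, ∀ j ∈ D, |cov[Y i, Y j; μ] - cov[trunc μ T Y i, trunc μ T Y j; μ]| ≤
      2 * C₂ * (1 + dist i j) ^ (-b) := by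
    intro i hi j hj
    have hci := hY.memLp hm hi (IsUnitLip.clip hT)
    have hcj := hY.memLp hm hj (IsUnitLip.clip hT)
    rw [hY.cov_trunc_trunc_eq hm hT hi hj]
    have e : cov[Y i, Y j; μ] - cov[fun ω => clip T (Y i ω), fun ω => clip T (Y j ω); μ] =
        cov[fun ω => Y i ω - clip T (Y i ω), fun ω => Y j ω; μ] +
        cov[fun ω => Y j ω - clip T (Y j ω), fun ω => clip T (Y i ω); μ] := by
      rw [covariance_fun_sub_left (hmem i hi) hci (hmem j hj),
        covariance_fun_sub_left (hmem j hj) hcj hci, covariance_comm (Y j) fun ω => clip T (Y i ω),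
        covariance_comm (fun ω => clip T (Y j ω)) fun ω => clip T (Y i ω)]
      ring
    rw [e]
    refine (abs_add_le _ _).trans ?_
    have t1 := htail i hi j hj _ IsUnitLip.id
    have t2 := htail j hj i hi _ (IsUnitLip.clip hT)
    rw [dist_comm j i] at t2
    linarith
  have h4 := sum_abs_le (by positivity) h3 hS subset_rfl
  have h5 : |∑ i ∈ D, ∑ j ∈ D with ¬ dist i j ≤ r, cov[trunc μ T Y i, trunc μ T Y j; μ]| ≤
      D.card * (C₁ * (S * (1 + r) ^ (-(a - b)))) := by
    rw [← nsmul_eq_mul, ← Finset.sum_const]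
    refine (Finset.abs_sum_le_sum_abs _ _).trans (Finset.sum_le_sum fun i hi => ?_)
    refine (Finset.abs_sum_le_sum_abs _ _).trans ?_
    calc _ ≤ ∑ j ∈ D with ¬ dist i j ≤ r, C₁ * (1 + dist i j) ^ (-a) :=
          Finset.sum_le_sum fun j hj => hc i hi j (Finset.mem_filter.1 hj).1
      _ ≤ _ := by
        rw [← Finset.mul_sum]
        exact mul_le_mul_of_nonneg_left (sum_filter_not_le_rpow hba (hS i hi) hr) hC₁
  -- Two errors are separated: truncating the variables in every covariance, and discarding the
  -- pairs at distance more than `r`.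
  have e : Var[fun ω => ∑ i ∈ D, Y i ω; μ] -
      ∫ ω, ∑ i ∈ D, trunc μ T Y i ω * ∑ j ∈ D with dist i j ≤ r, trunc μ T Y j ω ∂μ =
      ∑ i ∈ D, ∑ j ∈ D, (cov[Y i, Y j; μ] - cov[trunc μ T Y i, trunc μ T Y j; μ]) +
      ∑ i ∈ D, ∑ j ∈ D with ¬ dist i j ≤ r, cov[trunc μ T Y i, trunc μ T Y j; μ] := by
    rw [h1, h2]
    simp only [Finset.sum_sub_distrib]
    have : ∑ i ∈ D, ∑ j ∈ D, cov[trunc μ T Y i, trunc μ T Y j; μ] =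
        ∑ i ∈ D, ∑ j ∈ D with dist i j ≤ r, cov[trunc μ T Y i, trunc μ T Y j; μ] +
        ∑ i ∈ D, ∑ j ∈ D with ¬ dist i j ≤ r, cov[trunc μ T Y i, trunc μ T Y j; μ] := by
      rw [← Finset.sum_add_distrib]
      exact Finset.sum_congr rfl fun i _ => (Finset.sum_filter_add_sum_filter_not _ _ _).symm
    rw [this]
    ring
  rw [e]
  refine (abs_add_le _ _).trans ?_
  linarith

/-- As the `Y i` are centred, the difference is the centred sum of the tails. Its `L¹` norm is at
most its standard deviation, and every tail covariance carries the small factor `C₂`. -/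
theorem integral_abs_sum_sub_trunc_le (hY : WeakArray m K α κ s₀ μ Y D) (hm : 2 ≤ m)
    {b C₂ S T : ℝ} (hT : 0 ≤ T) (hC₂ : 0 ≤ C₂)
    (htail : ∀ i ∈ D, ∀ j ∈ D, ∀ h' : ℝ → ℝ, IsUnitLip h' →
      |cov[fun ω => Y i ω - clip T (Y i ω), fun ω => h' (Y j ω); μ]| ≤
        C₂ * (1 + dist i j) ^ (-b))
    (hS : ∀ i ∈ D, ∑ j ∈ D, (1 + dist i j) ^ (-b) ≤ S) :
    ∫ ω, |∑ i ∈ D, Y i ω - ∑ i ∈ D, trunc μ T Y i ω| ∂μ ≤ √(D.card * (C₂ * S)) := by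
  have hR : ∀ i ∈ D, MemLp (fun ω => Y i ω - clip T (Y i ω)) 2 μ := fun i hi =>
    hY.memLp hm hi (IsUnitLip.sub_clip hT)
  set R : Ω → ℝ := fun ω => ∑ i ∈ D, (Y i ω - clip T (Y i ω)) with hRdef
  have hRm : MemLp R 2 μ := memLp_finsetSum D hR
  have hmean : ∫ ω, R ω ∂μ = -∑ i ∈ D, ∫ ω, clip T (Y i ω) ∂μ := by
    simp only [hRdef]
    rw [integral_finsetSum _ fun i hi => (hR i hi).integrable (by simp), ← Finset.sum_neg_distrib]
    refine Finset.sum_congr rfl fun i hi => ?_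
    rw [integral_sub ((hY.memLp_self hm hi).integrable (by simp))
      ((hY.memLp hm hi (IsUnitLip.clip hT)).integrable (by simp)), hY.mean i hi, zero_sub]
  have e : ∀ ω, ∑ i ∈ D, Y i ω - ∑ i ∈ D, trunc μ T Y i ω = -(∫ ω, R ω ∂μ - R ω) := by
    intro ω
    rw [hmean]
    simp only [hRdef, trunc, Finset.sum_sub_distrib]
    ring
  simp_rw [e, abs_neg]
  refine (integral_abs_sub_le hRm _).trans ?_
  rw [sub_self, abs_zero, zero_add]
  refine Real.sqrt_le_sqrt ?_
  rw [← covariance_self hRm.aestronglyMeasurable.aemeasurable]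
  simp only [hRdef]
  rw [covariance_fun_sum_fun_sum' hR hR]
  exact (le_abs_self _).trans (sum_abs_le hC₂ (fun i hi j hj => htail i hi j hj _
    (IsUnitLip.sub_clip hT)) hS subset_rfl)

/-- The far part is a sum of clipped variables minus a constant, so composing it with `u *` and `ψ`
gives a function bounded by `1` with `ℓ¹` Lipschitz constant `|u|`. Since `Z i` is centred, the
integral is a covariance, to which the long-range bound applies. -/
theorem abs_integral_mul_trunc_le (hY : WeakArray m K α κ s₀ μ Y D) (hm : 2 ≤ m) {T r ℓ e : ℝ}
    (hT : 0 ≤ T) (hL : LongRange μ Y D T r ℓ e) {i : E} (hi : i ∈ D) {ψ : ℝ → ℝ}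
    (hψ : ∀ x, |ψ x| ≤ 1) (hψ' : ∀ x y, |ψ x - ψ y| ≤ |x - y|) {u : ℝ} (hu : |u| ≤ ℓ) :
    |∫ ω, ψ (u * (∑ j ∈ D, trunc μ T Y j ω - ∑ j ∈ D with dist i j ≤ r, trunc μ T Y j ω)) *
      trunc μ T Y i ω ∂μ| ≤ e := by
  set U := D.filter fun j => ¬ dist i j ≤ r with hU
  have hUD : U ⊆ D := Finset.filter_subset _ _
  set q : ℝ := ∑ j ∈ U, ∫ ω, clip T (Y j ω) ∂μ with hq
  set f : (U → ℝ) → ℝ := fun x => ψ (u * (∑ j, clip T (x j) - q)) with hf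
  have hfb : BddLip f 1 ℓ := by
    refine ⟨fun x => hψ _, (abs_nonneg _).trans hu, fun x y => (hψ' _ _).trans ?_⟩
    rw [← mul_sub, abs_mul, sub_sub_sub_cancel_right, ← Finset.sum_sub_distrib]
    refine mul_le_mul hu ((Finset.abs_sum_le_sum_abs _ _).trans
      (Finset.sum_le_sum fun k _ => abs_clip_sub_clip_le T _ _)) (abs_nonneg _)
      ((abs_nonneg _).trans hu)
  have hsum : ∀ ω, ∑ j ∈ D, trunc μ T Y j ω - ∑ j ∈ D with dist i j ≤ r, trunc μ T Y j ω =
      ∑ j : U, clip T (restr Y U ω j) - q := by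
    intro ω
    rw [← Finset.sum_filter_add_sum_filter_not D (fun j => dist i j ≤ r), add_sub_cancel_left, hq]
    simp only [trunc, Finset.sum_sub_distrib, restr]
    rw [Finset.sum_coe_sort U fun j => clip T (Y j ω)]
  have hfm : Measurable fun ω => f (restr Y U ω) :=
    hfb.continuous.measurable.comp (measurable_pi_lambda _ fun j =>
      hY.measurable j (hUD j.2))
  have hfL : MemLp (fun ω => f (restr Y U ω)) 2 μ :=
    MemLp.of_bound hfm.aestronglyMeasurable 1 (.of_forall fun ω => hfb.abs_le _)
  have key := hL i hi U hUD (fun j hj => by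
    rw [dist_comm]; exact (not_le.1 (Finset.mem_filter.1 hj).2).le) f hfb
  rw [covariance_comm, ← hY.cov_trunc_eq hm hT hi, covariance_comm,
    covariance_eq_sub hfL (hY.memLp_trunc hT hi 2), hY.integral_trunc hT hi, mul_zero,
    sub_zero] at key
  simp_rw [hsum]
  exact key

/-- The quantitative form of the Stein equation for the truncated sum, normalised by the standard
deviation of the full sum. -/
theorem norm_stein_trunc_le (hY : WeakArray m K α κ s₀ μ Y D) (hm : 2 ≤ m) (hκ : 0 ≤ κ)
    (hα : 0 ≤ α) (hs₀ : 1 ≤ s₀) {a b C₁ C₂ S T r ℓ e σ t : ℝ} (hT : 0 ≤ T) (hr : 0 ≤ r)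
    (hb : 0 ≤ b) (hba : b ≤ a) (hbα : b ≤ α) (hC₁ : 0 ≤ C₁) (hC₂ : 0 ≤ C₂)
    (hc : ∀ i ∈ D, ∀ j ∈ D, |cov[trunc μ T Y i, trunc μ T Y j; μ]| ≤ C₁ * (1 + dist i j) ^ (-a))
    (htail : ∀ i ∈ D, ∀ j ∈ D, ∀ h' : ℝ → ℝ, IsUnitLip h' →
      |cov[fun ω => Y i ω - clip T (Y i ω), fun ω => h' (Y j ω); μ]| ≤
        C₂ * (1 + dist i j) ^ (-b))
    (hS : ∀ i ∈ D, ∑ j ∈ D, (1 + dist i j) ^ (-b) ≤ S) (hσ : 0 < σ)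
    (hσ2 : σ ^ 2 = Var[fun ω => ∑ i ∈ D, Y i ω; μ])
    (hL : LongRange μ Y D T r ℓ e) (ht : |t| * σ⁻¹ ≤ ℓ) {W : Ω → ℝ}
    (hW : ∀ ω, W ω = σ⁻¹ * ∑ i ∈ D, trunc μ T Y i ω) :
    ‖∫ ω, Complex.I * W ω * Complex.exp (Complex.I * ((t * W ω : ℝ) : ℂ)) ∂μ +
        t * ∫ ω, Complex.exp (Complex.I * ((t * W ω : ℝ) : ℂ)) ∂μ‖ ≤
      σ⁻¹ * (D.card * (2 * e)) +
      |t| * ((σ ^ 2)⁻¹ * (D.card * (2 * C₂ * S + C₁ * (S * (1 + r) ^ (-(a - b)))))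
        + (σ ^ 2)⁻¹ * √((2 * (2 * T) ^ 4 * (1 + s₀) ^ α + κ * (6 * (2 * T) ^ 3) * 2 ^ α) * 3 ^ α *
        (D.card * (3 * S * (S * (1 + 3 * r) ^ b) ^ 2)))) +
      2 * (σ ^ 3)⁻¹ * (2 * T) * t ^ 2 * (D.card * (S * (1 + r) ^ b * (C₁ * S))) := by
  have hmono : ∀ i : E, ∀ {x y : ℝ}, x ≤ y →
      ∑ j ∈ D, (1 + dist i j) ^ (-y) ≤ ∑ j ∈ D, (1 + dist i j) ^ (-x) := fun i x y hxy =>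
    Finset.sum_le_sum fun j _ => Real.rpow_le_rpow_of_exponent_le
      (by linarith [dist_nonneg (x := i) (y := j)]) (by linarith)
  have hSa : ∀ i ∈ D, ∑ j ∈ D, (1 + dist i j) ^ (-a) ≤ S := fun i hi =>
    (hmono i hba).trans (hS i hi)
  have hSα : ∀ i ∈ D, ∑ j ∈ D, (1 + dist i j) ^ (-α) ≤ S := fun i hi =>
    (hmono i hbα).trans (hS i hi)
  refine (norm_stein_le (N := fun i => D.filter fun j => dist i j ≤ r)
    (fun i _ => Finset.filter_subset _ _) (fun i hi => hY.measurable_trunc T hi)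
    (by positivity : 0 ≤ 2 * T) (fun i _ => abs_trunc_le hT i) hσ hW (R := fun i ω =>
      ∑ j ∈ D, trunc μ T Y j ω - ∑ j ∈ D with dist i j ≤ r, trunc μ T Y j ω)
    (fun _ _ _ => rfl) t).trans (add_le_add_three ?_ ?_ ?_)
  · rw [← nsmul_eq_mul D.card, ← Finset.sum_const]
    gcongr with i hi
    have hmeas : Measurable fun ω => t * σ⁻¹ * (∑ j ∈ D, trunc μ T Y j ω -
        ∑ j ∈ D with dist i j ≤ r, trunc μ T Y j ω) :=
      ((Finset.measurable_fun_sum D fun j hj => hY.measurable_trunc T hj).sub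
        (Finset.measurable_fun_sum _ fun j hj =>
          hY.measurable_trunc T (Finset.mem_filter.1 hj).1)).const_mul _
    refine (norm_integral_mul_exp_le ((hY.memLp_trunc hT hi 1).integrable le_rfl) hmeas).trans ?_
    have hu : |t * σ⁻¹| ≤ ℓ := by rwa [abs_mul, abs_of_pos (inv_pos.2 hσ)]
    have h1 := hY.abs_integral_mul_trunc_le hm hT hL hi Real.abs_cos_le_one
      Real.abs_cos_sub_cos_le hu
    have h2 := hY.abs_integral_mul_trunc_le hm hT hL hi Real.abs_sin_le_one
      Real.abs_sin_sub_sin_le hu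
    linarith
  · gcongr
    set Q0 : Ω → ℝ := fun ω =>
      ∑ i ∈ D, trunc μ T Y i ω * ∑ j ∈ D with dist i j ≤ r, trunc μ T Y j ω with hQ0
    have hQ : MemLp Q0 2 μ := memLp_finsetSum D fun i hi =>
      (memLp_finsetSum _ fun j hj => hY.memLp_trunc hT (Finset.mem_filter.1 hj).1 ∞).mul
        (hY.memLp_trunc hT hi 2)
    have hv := hY.variance_sum_trunc_mul_le hκ hα hs₀ hT hr hSα (G := S * (1 + 3 * r) ^ b)
      fun i hi => card_filter_dist_le hb (hS i hi) (by positivity)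
    refine (integral_abs_sub_le (hQ.const_mul (σ ^ 2)⁻¹) 1).trans (add_le_add ?_ ?_)
    · rw [integral_const_mul]
      have e1 : (1 : ℝ) - (σ ^ 2)⁻¹ * ∫ ω, Q0 ω ∂μ =
          (σ ^ 2)⁻¹ * (σ ^ 2 - ∫ ω, Q0 ω ∂μ) := by field_simp
      rw [e1, abs_mul, abs_of_pos (by positivity)]
      refine mul_le_mul_of_nonneg_left ?_ (by positivity)
      rw [hσ2]
      exact hY.abs_variance_sub_local_le hm hT hr hba hC₁ hC₂ hc htail hS
    · rw [variance_const_mul, Real.sqrt_mul (by positivity), Real.sqrt_sq (by positivity)]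
      gcongr
  · rw [← nsmul_eq_mul D.card, ← Finset.sum_const]
    gcongr with i hi
    refine (hY.integral_sum_trunc_sq_le hT hC₁ hc hSa (Finset.filter_subset _ _)).trans ?_
    have hS0 : 0 ≤ S := (Finset.sum_nonneg fun j _ => by positivity).trans (hS i hi)
    gcongr
    exact card_filter_dist_le hb (hS i hi) hr

end WeakArray

/-! ### Passage to the limit. -/

/-- This encodes the order of limits: `n → ∞` at a fixed truncation level `T`, then `T → ∞`. -/
theorem tendsto_zero_of_le_add {u : ℕ → ℝ} {F : ℝ → ℝ} (hu : ∀ n, 0 ≤ u n)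
    (hF : Tendsto F atTop (𝓝 0))
    (h : ∀ T, 0 < T → ∃ η : ℕ → ℝ, Tendsto η atTop (𝓝 0) ∧ ∀ᶠ n in atTop, u n ≤ F T + η n) :
    Tendsto u atTop (𝓝 0) := by
  rw [Metric.tendsto_nhds]
  intro ε hε
  obtain ⟨T, hFT, hT⟩ := ((hF.eventually (gt_mem_nhds (half_pos hε))).and
    (eventually_gt_atTop 0)).exists
  obtain ⟨η, hη, hle⟩ := h T hT
  filter_upwards [hle, hη.eventually (gt_mem_nhds (half_pos hε))] with n h1 h2
  rw [Real.dist_eq, sub_zero, abs_of_nonneg (hu n)]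
  linarith

theorem tendsto_one_add_mul_rpow_mul_inv_sqrt {x : ℕ → ℝ} (hx : Tendsto x atTop atTop) {γ b k : ℝ}
    (hγ : 0 ≤ γ) (hb : 0 ≤ b) (hγb : γ * b < 1 / 2) (hk : 0 ≤ k) :
    Tendsto (fun n => (1 + k * x n ^ γ) ^ b * (√(x n))⁻¹) atTop (𝓝 0) := by
  have h := ((tendsto_rpow_neg_atTop (by linarith : 0 < 1 / 2 - γ * b)).comp hx).const_mul
    ((1 + k) ^ b)
  rw [mul_zero] at h
  refine squeeze_zero' ?_ ?_ h
  · filter_upwards [hx.eventually_ge_atTop 1] with n hn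
    have : 0 ≤ x n := by linarith
    positivity
  · filter_upwards [hx.eventually_ge_atTop 1] with n hn
    have h0 : 0 < x n := by linarith
    have h1 : 1 + k * x n ^ γ ≤ (1 + k) * x n ^ γ := by
      have := Real.one_le_rpow hn hγ
      linarith
    calc (1 + k * x n ^ γ) ^ b * (√(x n))⁻¹ ≤ ((1 + k) * x n ^ γ) ^ b * (√(x n))⁻¹ := by gcongr
      _ = (1 + k) ^ b * x n ^ (-(1 / 2 - γ * b)) := by
        rw [Real.mul_rpow (by positivity) (by positivity), ← Real.rpow_mul h0.le,
          Real.sqrt_eq_rpow, ← Real.rpow_neg h0.le, mul_assoc, ← Real.rpow_add h0]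
        congr 2
        ring

/-- Only `σ² ≥ c₀ x` is used to normalise, with `x` the number of sites. The term in `A` is kept
apart because it comes from truncation and does not vanish as `x → ∞` with `T` fixed. -/
theorem stein_error_le {x σ c₀ e s t A B Q q T S C r : ℝ} (hx : 0 < x) (hσ : 0 < σ) (hc₀ : 0 < c₀)
    (hxσ : c₀ * x ≤ σ ^ 2) (he : 0 ≤ e) (hst : |s| ≤ |t|) (hA : 0 ≤ A) (hB : 0 ≤ B) (hQ : 0 ≤ Q)
    (hq : 0 ≤ q) (hT : 0 ≤ T) (hS : 0 ≤ S) (hC : 0 ≤ C) (hr : 0 ≤ r) :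
    σ⁻¹ * (x * (2 * e)) + |s| * ((σ ^ 2)⁻¹ * (x * (A + B)) +
      (σ ^ 2)⁻¹ * √(Q * (x * (3 * S * (S * q) ^ 2)))) +
      2 * (σ ^ 3)⁻¹ * (2 * T) * s ^ 2 * (x * (S * r * (C * S))) ≤
    |t| * c₀⁻¹ * A + ((√c₀)⁻¹ * 2 * (√x * e) + |t| * c₀⁻¹ * B +
      |t| * c₀⁻¹ * √(Q * (3 * S)) * S * (q * (√x)⁻¹) +
      4 * (√c₀)⁻¹ ^ 3 * T * t ^ 2 * (S * (C * S)) * (r * (√x)⁻¹)) := by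
  have hsx : 0 < √x := Real.sqrt_pos.2 hx
  have hsc : 0 < √c₀ := Real.sqrt_pos.2 hc₀
  have hxx : √x * √x = x := Real.mul_self_sqrt hx.le
  have h1 : σ⁻¹ ≤ (√c₀)⁻¹ * (√x)⁻¹ := by
    rw [← mul_inv]
    refine inv_anti₀ (by positivity) ?_
    rw [← Real.sqrt_mul hc₀.le]
    exact (Real.sqrt_le_sqrt hxσ).trans (by rw [Real.sqrt_sq hσ.le])
  have h2 : (σ ^ 2)⁻¹ ≤ c₀⁻¹ * x⁻¹ := by
    rw [← mul_inv]
    exact inv_anti₀ (by positivity) hxσ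
  have h3 : (σ ^ 3)⁻¹ ≤ ((√c₀)⁻¹ * (√x)⁻¹) ^ 3 := by
    rw [← inv_pow]
    gcongr
  have hs2 : s ^ 2 ≤ t ^ 2 := sq_le_sq.2 hst
  have e1 : σ⁻¹ * (x * (2 * e)) ≤ (√c₀)⁻¹ * 2 * (√x * e) := by
    calc _ ≤ (√c₀)⁻¹ * (√x)⁻¹ * (x * (2 * e)) := by gcongr
      _ = _ := by
        nth_rw 2 [← hxx]
        field_simp
  have e2 : (σ ^ 2)⁻¹ * (x * (A + B)) ≤ c₀⁻¹ * (A + B) := by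
    calc _ ≤ c₀⁻¹ * x⁻¹ * (x * (A + B)) := by gcongr
      _ = _ := by field_simp
  have e3 : (σ ^ 2)⁻¹ * √(Q * (x * (3 * S * (S * q) ^ 2))) ≤
      c₀⁻¹ * √(Q * (3 * S)) * S * (q * (√x)⁻¹) := by
    have : Q * (x * (3 * S * (S * q) ^ 2)) = Q * (3 * S) * (√x * (S * q)) ^ 2 := by
      rw [mul_pow (√x), Real.sq_sqrt hx.le]; ring
    rw [this, Real.sqrt_mul (by positivity), Real.sqrt_sq (by positivity)]
    calc _ ≤ c₀⁻¹ * x⁻¹ * (√(Q * (3 * S)) * (√x * (S * q))) := by gcongr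
      _ = _ := by
        nth_rw 1 [← hxx]
        field_simp
  have e4 : 2 * (σ ^ 3)⁻¹ * (2 * T) * s ^ 2 * (x * (S * r * (C * S))) ≤
      4 * (√c₀)⁻¹ ^ 3 * T * t ^ 2 * (S * (C * S)) * (r * (√x)⁻¹) := by
    calc _ ≤ 2 * ((√c₀)⁻¹ * (√x)⁻¹) ^ 3 * (2 * T) * t ^ 2 * (x * (S * r * (C * S))) := by gcongr
      _ = _ := by
        nth_rw 2 [← hxx]
        field_simp
        ring
  have e23 : |s| * ((σ ^ 2)⁻¹ * (x * (A + B)) +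
      (σ ^ 2)⁻¹ * √(Q * (x * (3 * S * (S * q) ^ 2)))) ≤
      |t| * (c₀⁻¹ * (A + B) + c₀⁻¹ * √(Q * (3 * S)) * S * (q * (√x)⁻¹)) := by
    gcongr
  linarith

theorem norm_exp_sub_exp_le (x y : ℝ) :
    ‖Complex.exp (Complex.I * (x : ℂ)) - Complex.exp (Complex.I * (y : ℂ))‖ ≤ |x - y| := by
  have e : Complex.exp (Complex.I * (x : ℂ)) - Complex.exp (Complex.I * (y : ℂ)) =
      Complex.exp (Complex.I * (y : ℂ)) *
        (Complex.exp (Complex.I * ((x - y : ℝ) : ℂ)) - 1) := by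
    rw [mul_sub, mul_one, ← Complex.exp_add]
    congr 2
    push_cast
    ring
  rw [e, norm_mul, Complex.norm_exp_I_mul_ofReal, one_mul]
  exact Real.norm_exp_I_mul_ofReal_sub_one_le

theorem integrable_exp_I_mul {Ω : Type*} [MeasurableSpace Ω] {μ : Measure Ω} [IsFiniteMeasure μ]
    {W : Ω → ℝ} (hW : Integrable W μ) (t : ℝ) :
    Integrable (fun ω => Complex.exp (Complex.I * ((t * W ω : ℝ) : ℂ))) μ :=
  Integrable.of_bound ((by fun_prop : Continuous fun y : ℝ =>
    Complex.exp (Complex.I * ((t * y : ℝ) : ℂ))).comp_aestronglyMeasurable hW.aestronglyMeasurable) 1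
    (.of_forall fun ω => by rw [Complex.norm_exp_I_mul_ofReal])

/-- Convergence of the characteristic functions for weakly dependent arrays with bounded
moments. -/
theorem tendsto_integral_exp_of_weakArray {E : Type*} [NormedAddCommGroup E] [NormedSpace ℝ E]
    [FiniteDimensional ℝ E] {L : Set E} (hL : IsLattice L) {D : ℕ → Finset E}
    (hDL : ∀ n, (D n : Set E) ⊆ L) (hD : Tendsto (fun n => (D n).card) atTop atTop)
    {Ω : ℕ → Type*} [∀ n, MeasurableSpace (Ω n)] {μ : ∀ n, Measure (Ω n)}
    [∀ n, IsProbabilityMeasure (μ n)] {Y : ∀ n, E → Ω n → ℝ} {m K α κ s₀ c₀ γ : ℝ} (hm : 2 < m)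
    (hK : 0 ≤ K) (hκ : 0 ≤ κ) (hs₀ : 1 ≤ s₀)
    (hα : (Module.finrank ℝ E : ℝ) < α * (m - 2) / (m - 1))
    (hY : ∀ᶠ n in atTop, WeakArray m K α κ s₀ (μ n) (Y n) (D n)) (hc₀ : 0 < c₀)
    (hvar : ∀ᶠ n in atTop, c₀ * (D n).card ≤ Var[fun ω => ∑ i ∈ D n, Y n i ω; μ n])
    (hγ : 0 < γ) (hγd : γ * Module.finrank ℝ E < 1 / 2)
    (hlong : ∀ T, 0 < T → ∀ Λ, 0 ≤ Λ → ∃ e : ℕ → ℝ,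
      Tendsto (fun n => √((D n).card : ℝ) * e n) atTop (𝓝 0) ∧ (∀ n, 0 ≤ e n) ∧
      ∀ᶠ n in atTop, LongRange (μ n) (Y n) (D n) T (((D n).card : ℝ) ^ γ)
        (Λ / √((D n).card : ℝ)) (e n)) (t : ℝ) :
    Tendsto (fun n => ∫ ω, Complex.exp (Complex.I *
      ((t * ((√Var[fun ω => ∑ i ∈ D n, Y n i ω; μ n])⁻¹ * ∑ i ∈ D n, Y n i ω) : ℝ) : ℂ)) ∂(μ n))
      atTop (𝓝 (Complex.exp (-(t : ℂ) ^ 2 / 2))) := by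
  set a : ℝ := α * (m - 2) / (m - 1) with ha
  set d : ℝ := (Module.finrank ℝ E : ℝ) with hd
  have hd0 : 0 ≤ d := Nat.cast_nonneg _
  -- The exponent `b` serves three purposes: `b > d` gives summability, `b < a` leaves decay beyond
  -- radius `r` and room for a gain in `T`, and `γ b < 1/2` keeps ball cardinalities negligible
  -- against `√|D n|`.
  obtain ⟨b, hdb, hb⟩ : ∃ b, d < b ∧ b < min a (1 / 2 / γ) :=
    exists_between (lt_min hα (by rw [lt_div_iff₀ hγ]; linarith))
  have hba : b < a := hb.trans_le (min_le_left _ _)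
  have hγb : γ * b < 1 / 2 := by
    have := hb.trans_le (min_le_right _ _)
    rw [lt_div_iff₀ hγ] at this
    linarith
  have hb0 : 0 < b := hd0.trans_lt hdb
  have ha0 : 0 < a := hb0.trans hba
  have hα0 : 0 < α := by
    by_contra h
    rw [not_lt] at h
    have : a ≤ 0 := by
      rw [ha]
      exact div_nonpos_of_nonpos_of_nonneg
        (mul_nonpos_of_nonpos_of_nonneg h (by linarith)) (by linarith)
    linarith
  have haα : a ≤ α := by
    rw [ha, div_le_iff₀ (by linarith)]
    nlinarith
  obtain ⟨S, hS0, hS⟩ := hL.exists_sum_le (a := b) hdb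
  set C : ℝ := 2 + 2 * K + (1 + K) ^ 2 with hC
  have hC0 : 0 ≤ C := by positivity
  set C₁ : ℝ := C * (1 + s₀) ^ a + 2 * (κ + C) * 2 ^ a with hC₁
  have hC₁0 : 0 ≤ C₁ := by positivity
  -- This weight satisfies `a (1 - θ) = b`, so the interpolated tail covariances remain summable
  -- while gaining `T^(-θ(m-2))`.
  set θ : ℝ := 1 - b / a with hθ
  have hθ0 : 0 < θ := by rw [hθ, sub_pos, div_lt_one ha0]; exact hba
  have hθ1 : θ ≤ 1 := by rw [hθ]; have := div_pos hb0 ha0; linarith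
  have haθ : a * (1 - θ) = b := by rw [hθ]; field_simp; ring
  set C₃ : ℝ := C₁ ^ (1 - θ) * C ^ θ with hC₃
  have hC₃0 : 0 ≤ C₃ := by positivity
  set C₂ : ℝ → ℝ := fun T => C₃ * T ^ (-(θ * (m - 2))) with hC₂
  have hC₂lim : Tendsto C₂ atTop (𝓝 0) := by
    simpa using (tendsto_rpow_neg_atTop (mul_pos hθ0 (by linarith : 0 < m - 2))).const_mul C₃
  set x : ℕ → ℝ := fun n => (D n).card with hx
  have hxlim : Tendsto x atTop atTop := tendsto_natCast_atTop_atTop.comp hD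
  -- `F` collects the errors that survive `n → ∞`: the effect of truncation on the variance, and the
  -- replacement of the sum by the truncated sum.
  set F : ℝ → ℝ := fun T => |t| * (|t| * c₀⁻¹ * (2 * C₂ T * S)) + |t| * √(c₀⁻¹ * (C₂ T * S)) with hF
  have hFlim : Tendsto F atTop (𝓝 0) := by
    have h1 : Tendsto (fun T => |t| * (|t| * c₀⁻¹ * (2 * C₂ T * S))) atTop (𝓝 0) := by
      simpa using (((hC₂lim.const_mul 2).mul_const S).const_mul (|t| * c₀⁻¹)).const_mul |t|
    have h2 : Tendsto (fun T => |t| * √(c₀⁻¹ * (C₂ T * S))) atTop (𝓝 0) := by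
      have := (((hC₂lim.mul_const S).const_mul c₀⁻¹).sqrt).const_mul |t|
      simpa using this
    simpa using h1.add h2
  rw [tendsto_iff_norm_sub_tendsto_zero]
  refine tendsto_zero_of_le_add (fun n => norm_nonneg _) hFlim fun T hT => ?_
  -- The far part is multiplied by a slope of modulus at most `|t| / σ`, and `σ ≥ √c₀ √|D n|`; this
  -- fixes `Λ`.
  obtain ⟨e, helim, he0, hLR⟩ := hlong T hT (|t| * (√c₀)⁻¹) (by positivity)
  set H : ℝ := (2 * (2 * T) ^ 4 * (1 + s₀) ^ α + κ * (6 * (2 * T) ^ 3) * 2 ^ α) * 3 ^ α with hH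
  have hH0 : 0 ≤ H := by positivity
  refine ⟨fun n => |t| * ((√c₀)⁻¹ * 2 * (√(x n) * e n) +
      |t| * c₀⁻¹ * (C₁ * (S * (1 + x n ^ γ) ^ (-(a - b)))) +
      |t| * c₀⁻¹ * √(H * (3 * S)) * S * ((1 + 3 * x n ^ γ) ^ b * (√(x n))⁻¹) +
      4 * (√c₀)⁻¹ ^ 3 * T * t ^ 2 * (S * (C₁ * S)) * ((1 + x n ^ γ) ^ b * (√(x n))⁻¹)), ?_, ?_⟩
  · have l1 : Tendsto (fun n => (1 + x n ^ γ) ^ (-(a - b))) atTop (𝓝 0) :=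
      (tendsto_rpow_neg_atTop (sub_pos.2 hba)).comp
        (tendsto_atTop_add_const_left _ 1 ((tendsto_rpow_atTop hγ).comp hxlim))
    have l2 := tendsto_one_add_mul_rpow_mul_inv_sqrt hxlim hγ.le hb0.le hγb zero_le_three
    have l3 := tendsto_one_add_mul_rpow_mul_inv_sqrt hxlim hγ.le hb0.le hγb zero_le_one
    simp only [one_mul] at l3
    have l4 := (((helim.const_mul ((√c₀)⁻¹ * 2)).add
      (((l1.const_mul S).const_mul C₁).const_mul (|t| * c₀⁻¹))).add
      (l2.const_mul (|t| * c₀⁻¹ * √(H * (3 * S)) * S))).add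
      (l3.const_mul (4 * (√c₀)⁻¹ ^ 3 * T * t ^ 2 * (S * (C₁ * S)))) |>.const_mul |t|
    simp only [mul_zero, add_zero] at l4
    exact l4
  · filter_upwards [hY, hvar, hLR, hxlim.eventually_gt_atTop 0] with n hYn hvn hLn hxn
    set σ : ℝ := √Var[fun ω => ∑ i ∈ D n, Y n i ω; μ n] with hσ
    have hcx : 0 < c₀ * x n := mul_pos hc₀ hxn
    have hσ0 : 0 < σ := Real.sqrt_pos.2 (hcx.trans_le hvn)
    have hσ2 : σ ^ 2 = Var[fun ω => ∑ i ∈ D n, Y n i ω; μ n] := Real.sq_sqrt (variance_nonneg _ _)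
    have hC₂0 : 0 ≤ C₂ T := by positivity
    have hSn : ∀ i ∈ D n, ∑ j ∈ D n, (1 + dist i j) ^ (-b) ≤ S := fun i _ => hS i _ (hDL n)
    have hcov : ∀ i ∈ D n, ∀ j ∈ D n, |cov[trunc (μ n) T (Y n) i, trunc (μ n) T (Y n) j; μ n]| ≤
        C₁ * (1 + dist i j) ^ (-a) := fun i hi j hj => by
      rw [hYn.cov_trunc_trunc_eq hm.le hT.le hi hj]
      exact hYn.abs_cov_le hm hα0.le hκ hs₀ hi hj (IsUnitLip.clip hT.le) (IsUnitLip.clip hT.le)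
        hC ha
    have htail : ∀ i ∈ D n, ∀ j ∈ D n, ∀ h' : ℝ → ℝ, IsUnitLip h' →
        |cov[fun ω => Y n i ω - clip T (Y n i ω), fun ω => h' (Y n j ω); μ n]| ≤
        C₂ T * (1 + dist i j) ^ (-b) := fun i hi j hj h' hh' => by
      have := hYn.abs_cov_tail_le hm hα0.le hκ hs₀ hi hj hT hh' hC ha hθ0.le hθ1
      rw [haθ] at this
      exact this
    set W : Ω n → ℝ := fun ω => σ⁻¹ * ∑ i ∈ D n, trunc (μ n) T (Y n) i ω with hW
    have hWi : Integrable W (μ n) := (integrable_finsetSum _ fun i hi =>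
      (hYn.memLp_trunc hT.le hi 1).integrable le_rfl).const_mul _
    have hσinv : σ⁻¹ ≤ (√c₀)⁻¹ * (√(x n))⁻¹ := by
      rw [← mul_inv, ← Real.sqrt_mul hc₀.le]
      exact inv_anti₀ (Real.sqrt_pos.2 hcx) (Real.sqrt_le_sqrt hvn)
    have hgauss := norm_integral_exp_sub_le hWi (t := t) fun s hs =>
      (hYn.norm_stein_trunc_le hm.le hκ hα0.le hs₀ hT.le (r := x n ^ γ) (by positivity) hb0.le
        hba.le (hba.le.trans haα) hC₁0 hC₂0 hcov htail hSn hσ0 hσ2 hLn (t := s) (by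
          rw [mul_div_assoc, div_eq_mul_inv]
          exact mul_le_mul hs hσinv (by positivity) (by positivity)) (fun _ => rfl)).trans
      (stein_error_le hxn hσ0 hc₀ (hvn.trans hσ2.ge) (he0 n) hs (by positivity) (by positivity)
        hH0 (by positivity) hT.le hS0.le hC₁0 (by positivity))
    have hdiff : ‖∫ ω, Complex.exp (Complex.I * ((t * (σ⁻¹ * ∑ i ∈ D n, Y n i ω) : ℝ) : ℂ)) ∂(μ n) -
        ∫ ω, Complex.exp (Complex.I * ((t * W ω : ℝ) : ℂ)) ∂(μ n)‖ ≤
        |t| * √(c₀⁻¹ * (C₂ T * S)) := by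
      have hSi : Integrable (fun ω => ∑ i ∈ D n, Y n i ω) (μ n) := integrable_finsetSum _
        fun i hi => (hYn.memLp_self hm.le hi).integrable (by simp)
      have hZi : Integrable (fun ω => ∑ i ∈ D n, trunc (μ n) T (Y n) i ω) (μ n) :=
        integrable_finsetSum _ fun i hi => (hYn.memLp_trunc hT.le hi 1).integrable le_rfl
      have h1 := hYn.integral_abs_sum_sub_trunc_le hm.le hT.le hC₂0 htail hSn
      calc _ ≤ ∫ ω, |t| * σ⁻¹ * |∑ i ∈ D n, Y n i ω - ∑ i ∈ D n, trunc (μ n) T (Y n) i ω| ∂(μ n) := by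
            rw [← integral_sub (integrable_exp_I_mul (hSi.const_mul σ⁻¹) t)
              (integrable_exp_I_mul hWi t)]
            refine norm_integral_le_of_norm_le ((hSi.sub hZi).abs.const_mul _)
              (.of_forall fun ω => (norm_exp_sub_exp_le _ _).trans (le_of_eq ?_))
            simp only [hW]
            rw [← mul_sub, ← mul_sub, abs_mul, abs_mul, abs_of_pos (inv_pos.2 hσ0)]
            ring
        _ ≤ |t| * ((√c₀)⁻¹ * (√(x n))⁻¹) * √(x n * (C₂ T * S)) := by
            rw [integral_const_mul]
            gcongr
        _ = _ := by
            rw [Real.sqrt_mul hxn.le, Real.sqrt_mul (inv_nonneg.2 hc₀.le), Real.sqrt_inv]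
            have := (Real.sqrt_pos.2 hxn).ne'
            field_simp
    refine (norm_sub_le_norm_sub_add_norm_sub _
      (∫ ω, Complex.exp (Complex.I * ((t * W ω : ℝ) : ℂ)) ∂(μ n)) _).trans ?_
    simp only [hF]
    linarith

/-! ### From dependence coefficients to covariance bounds. -/

section Coefficients

variable {ι : Type*} [Fintype ι]

theorem BddLip.lip_le_ofReal {f : (ι → ℝ) → ℝ} {A L : ℝ} (hf : BddLip f A L) :
    lip f ≤ ENNReal.ofReal L := by
  refine iSup_le fun x => iSup_le fun y => iSup_le fun hxy => ENNReal.ofReal_le_ofReal ?_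
  have hpos : 0 < ∑ k, |x k - y k| := by
    obtain ⟨k, hk⟩ := Function.ne_iff.1 hxy
    exact Finset.sum_pos' (fun _ _ => abs_nonneg _)
      ⟨k, Finset.mem_univ k, abs_pos.2 (sub_ne_zero.2 hk)⟩
  rw [div_le_iff₀ hpos]
  exact hf.lip_le x y

theorem supNorm_le_ofReal {Ω : Type*} [MeasurableSpace Ω] {μ : Measure Ω} {Z : Ω → ℝ} {A : ℝ}
    (h : ∀ ω, |Z ω| ≤ A) : supNorm μ Z ≤ ENNReal.ofReal A :=
  sInf_le (Set.mem_ofPred.2 (.of_forall fun ω => ENNReal.ofReal_le_ofReal (h ω)))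

/-- A vanishing denominator is harmless: the quotient is then `∞` unless `x = 0`, and the finite
bound excludes `∞`. -/
theorem abs_le_of_ofReal_div_le {x τ y : ℝ} {b : ℝ≥0∞} (hτ : 0 ≤ τ) (hy : 0 ≤ y)
    (hb : b ≤ ENNReal.ofReal y) (h : ENNReal.ofReal |x| / b ≤ ENNReal.ofReal τ) :
    |x| ≤ τ * y := by
  rw [ENNReal.div_le_iff_le_mul (.inr ENNReal.ofReal_ne_top)
    (.inl (hb.trans_lt ENNReal.ofReal_lt_top).ne)] at h
  have h2 := h.trans (mul_le_mul_right hb _)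
  rw [← ENNReal.ofReal_mul hτ] at h2
  exact (ENNReal.ofReal_le_ofReal_iff (mul_nonneg hτ hy)).1 h2

variable {E Ω : Type*} [MeasurableSpace Ω] {μ : Measure Ω} {X : E → Ω → ℝ} {U V : Finset E}
  {f : (U → ℝ) → ℝ} {g : (V → ℝ) → ℝ} {A A' L L' τ : ℝ}

theorem abs_cov_le_of_thetaPair_le (hτ : 0 ≤ τ) (h : thetaPair μ X U V ≤ ENNReal.ofReal τ)
    (hf : BddLip f A L) (hg : BddLip g A' L') :
    |cov[fun ω => f (restr X U ω), fun ω => g (restr X V ω); μ]| ≤ τ * (V.card * A * L') := by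
  have h1 : supNorm μ (fun ω => f (restr X U ω)) ≤ ENNReal.ofReal A :=
    supNorm_le_ofReal fun ω => hf.abs_le _
  have hA := hf.nonneg
  have hle : _ ≤ thetaPair μ X U V := le_iSup₂_of_le f g (le_iSup_of_le
    ⟨hf.continuous.measurable, h1.trans_lt ENNReal.ofReal_lt_top,
      hg.lip_le_ofReal.trans_lt ENNReal.ofReal_lt_top⟩ le_rfl)
  refine abs_le_of_ofReal_div_le hτ (mul_nonneg (by positivity) hg.lip_nonneg) ?_ (hle.trans h)
  rw [ENNReal.ofReal_mul (by positivity), ENNReal.ofReal_mul (by positivity), ENNReal.ofReal_natCast]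
  gcongr
  exact hg.lip_le_ofReal

theorem abs_cov_le_of_etaPair_le (hτ : 0 ≤ τ) (h : etaPair μ X U V ≤ ENNReal.ofReal τ)
    (hf : BddLip f A L) (hg : BddLip g A' L') :
    |cov[fun ω => f (restr X U ω), fun ω => g (restr X V ω); μ]| ≤
      τ * (U.card * A' * L + V.card * A * L') := by
  have h1 : supNorm μ (fun ω => f (restr X U ω)) ≤ ENNReal.ofReal A :=
    supNorm_le_ofReal fun ω => hf.abs_le _
  have h2 : supNorm μ (fun ω => g (restr X V ω)) ≤ ENNReal.ofReal A' :=
    supNorm_le_ofReal fun ω => hg.abs_le _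
  have hA := hf.nonneg
  have hA' := hg.nonneg
  have hL := hf.lip_nonneg
  have hL' := hg.lip_nonneg
  have hle : _ ≤ etaPair μ X U V := le_iSup₂_of_le f g (le_iSup_of_le
    ⟨⟨h1.trans_lt ENNReal.ofReal_lt_top, hf.lip_le_ofReal.trans_lt ENNReal.ofReal_lt_top⟩,
      h2.trans_lt ENNReal.ofReal_lt_top, hg.lip_le_ofReal.trans_lt ENNReal.ofReal_lt_top⟩ le_rfl)
  refine abs_le_of_ofReal_div_le hτ (by positivity) ?_ (hle.trans h)
  rw [ENNReal.ofReal_add (by positivity) (by positivity), ENNReal.ofReal_mul (by positivity),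
    ENNReal.ofReal_mul (by positivity), ENNReal.ofReal_mul (by positivity),
    ENNReal.ofReal_mul (by positivity), ENNReal.ofReal_natCast, ENNReal.ofReal_natCast]
  gcongr
  exacts [hf.lip_le_ofReal, hg.lip_le_ofReal]

end Coefficients

section Decay

variable {E : Type*} [PseudoMetricSpace E] {D : ℕ → Finset E}
  {pair : ℕ → Finset E → Finset E → ℝ≥0∞}

theorem le_unifCoeff {n : ℕ} {U V : Finset E} {s : ℝ} (hU : U ⊆ D n) (hV : V ⊆ D n)
    (hs : ∀ i ∈ U, ∀ j ∈ V, s ≤ dist i j) :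
    pair n U V ≤ unifCoeff D pair U.card V.card s :=
  le_iSup_of_le n (le_iSup_of_le U (le_iSup_of_le V (le_iSup_of_le ⟨hU, hV, rfl, rfl, hs⟩ le_rfl)))

/-- Only finitely many pairs `(u, v)` occur, so the constants can be summed and one threshold
suffices. -/
theorem exists_bound_of_isBigOPow {ε : ℕ → ℕ → ℝ → ℝ≥0∞} {α : ℝ}
    (h : ∀ u v : ℕ, u + v ≤ 4 → IsBigOPow (ε u v) α) :
    ∃ κ s₀ : ℝ, 0 ≤ κ ∧ 1 ≤ s₀ ∧ ∀ s, s₀ ≤ s → ∀ u v : ℕ, u + v ≤ 4 →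
      ε u v s ≤ ENNReal.ofReal (κ * s ^ (-α)) := by
  choose! C hC using h
  set P : Finset (ℕ × ℕ) := (Finset.range 5 ×ˢ Finset.range 5).filter fun p => p.1 + p.2 ≤ 4 with hP
  have hmem : ∀ u v : ℕ, u + v ≤ 4 → (u, v) ∈ P := fun u v h => by
    simp only [hP, Finset.mem_filter, Finset.mem_product, Finset.mem_range]
    omega
  have hev : ∀ᶠ s : ℝ in atTop, ∀ p ∈ P, ε p.1 p.2 s ≤ C p.1 p.2 * ENNReal.ofReal (s ^ (-α)) :=
    (Finset.eventually_all P).2 fun p hp => hC p.1 p.2 (Finset.mem_filter.1 hp).2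
  obtain ⟨s₁, hs₁⟩ := eventually_atTop.1 hev
  refine ⟨∑ p ∈ P, (C p.1 p.2 : ℝ), max 1 s₁, by positivity, le_max_left _ _,
    fun s hs u v huv => ?_⟩
  have hs0 : 0 ≤ s := by linarith [(le_max_left 1 s₁).trans hs]
  refine (hs₁ s ((le_max_right _ _).trans hs) (u, v) (hmem u v huv)).trans ?_
  rw [ENNReal.ofReal_mul (by positivity)]
  gcongr
  rw [← ENNReal.ofReal_coe_nnreal]
  exact ENNReal.ofReal_le_ofReal (Finset.single_le_sum (f := fun p : ℕ × ℕ => (C p.1 p.2 : ℝ))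
    (fun _ _ => NNReal.coe_nonneg _) (hmem u v huv))

theorem exists_pair_singleton_le {β : ℝ}
    (h : IsBigOPow (fun s => ⨆ u : ℕ, unifCoeff D pair u 1 s) β) :
    ∃ C s₁ : ℝ, 0 ≤ C ∧ 1 ≤ s₁ ∧ ∀ s, s₁ ≤ s → ∀ n, ∀ U ⊆ D n, ∀ i ∈ D n,
      (∀ j ∈ U, s ≤ dist j i) → pair n U {i} ≤ ENNReal.ofReal (C * s ^ (-β)) := by
  obtain ⟨C, hC⟩ := h
  obtain ⟨s₁, hs₁⟩ := eventually_atTop.1 hC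
  refine ⟨C, max 1 s₁, C.2, le_max_left _ _, fun s hs n U hU i hi hd => ?_⟩
  refine (le_unifCoeff hU (Finset.singleton_subset_iff.2 hi) (s := s) (by simpa using hd)).trans ?_
  rw [Finset.card_singleton, ENNReal.ofReal_mul C.coe_nonneg, ENNReal.ofReal_coe_nnreal]
  exact (le_iSup (fun u => unifCoeff D pair u 1 s) U.card).trans
    (hs₁ s ((le_max_right _ _).trans hs))

variable {Ω : ℕ → Type*} [∀ n, MeasurableSpace (Ω n)] {μ : ∀ n, Measure (Ω n)}
  {X : ∀ n, E → Ω n → ℝ}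

/-- Polynomial decay of the coefficients bounds the covariances of functions of at most four
variables. -/
theorem exists_short_range {α : ℝ}
    (hpair : ∀ n (U V : Finset E) (f : (U → ℝ) → ℝ) (g : (V → ℝ) → ℝ) (A A' L L' τ : ℝ), 0 ≤ τ →
      pair n U V ≤ ENNReal.ofReal τ → BddLip f A L → BddLip g A' L' →
      |cov[fun ω => f (restr (X n) U ω), fun ω => g (restr (X n) V ω); μ n]| ≤
        τ * (U.card * A' * L + V.card * A * L'))
    (h : ∀ u v : ℕ, u + v ≤ 4 → IsBigOPow (unifCoeff D pair u v) α) :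
    ∃ κ s₀ : ℝ, 0 ≤ κ ∧ 1 ≤ s₀ ∧ ∀ n, ∀ U V : Finset E, U ⊆ D n → V ⊆ D n →
      U.card + V.card ≤ 4 → ∀ s : ℝ, s₀ ≤ s → (∀ i ∈ U, ∀ j ∈ V, s ≤ dist i j) →
      ∀ (f : (U → ℝ) → ℝ) (g : (V → ℝ) → ℝ) (A A' L L' : ℝ), BddLip f A L → BddLip g A' L' →
      |cov[fun ω => f (restr (X n) U ω), fun ω => g (restr (X n) V ω); μ n]| ≤
        κ * s ^ (-α) * (A * L' + A' * L) := by
  obtain ⟨κ, s₀, hκ, hs₀, hb⟩ := exists_bound_of_isBigOPow h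
  refine ⟨κ * 4, s₀, by positivity, hs₀, fun n U V hU hV hUV s hs hd f g A A' L L' hf hg => ?_⟩
  have hs0 : 0 ≤ s := by linarith
  refine (hpair n U V f g A A' L L' (κ * s ^ (-α)) (by positivity)
    ((le_unifCoeff hU hV hd).trans (hb s hs _ _ hUV)) hf hg).trans ?_
  have hu : (U.card : ℝ) ≤ 4 := by exact_mod_cast (by omega : U.card ≤ 4)
  have hv : (V.card : ℝ) ≤ 4 := by exact_mod_cast (by omega : V.card ≤ 4)
  have h1 := mul_nonneg hg.nonneg hf.lip_nonneg
  have h2 := mul_nonneg hf.nonneg hg.lip_nonneg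
  calc _ ≤ κ * s ^ (-α) * (4 * (A' * L) + 4 * (A * L')) := by
        rw [mul_assoc (U.card : ℝ), mul_assoc (V.card : ℝ)]
        gcongr
    _ = _ := by ring

end Decay

section Scaling

variable {E : Type*} {Ω : Type*} {X : E → Ω → ℝ}

theorem restr_const_mul (r : ℝ) (U : Finset E) (ω : Ω) :
    restr (fun i ω => r * X i ω) U ω = fun k => r * restr X U ω k := rfl

variable [PseudoMetricSpace E] {D : Finset E} [MeasurableSpace Ω] {μ : Measure Ω}

/-- The coefficients are measured on `X`, not on `r X`. Precomposing with multiplication by `r`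
preserves sup bounds and multiplies Lipschitz constants by `r ≤ r₀`, so only the constant `κ`
changes. An upper bound on `r = M_n⁻¹` is enough, and `M_n` may grow. -/
theorem WeakArray.of_const_mul {m K α κ s₀ r r₀ : ℝ} (hr : 0 ≤ r) (hr₀ : r ≤ r₀)
    (hκ : 0 ≤ κ) (hs₀ : 0 ≤ s₀) (hX : ∀ i ∈ D, Measurable (X i))
    (hmean : ∀ i ∈ D, ∫ ω, X i ω ∂μ = 0)
    (hint : ∀ i ∈ D, Integrable (fun ω => |r * X i ω| ^ m) μ)
    (hK : ∀ i ∈ D, ∫ ω, |r * X i ω| ^ m ∂μ ≤ K)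
    (hcov : ∀ U V : Finset E, U ⊆ D → V ⊆ D →
      U.card + V.card ≤ 4 → ∀ s : ℝ, s₀ ≤ s → (∀ i ∈ U, ∀ j ∈ V, s ≤ dist i j) →
      ∀ (f : (U → ℝ) → ℝ) (g : (V → ℝ) → ℝ) (A A' L L' : ℝ), BddLip f A L → BddLip g A' L' →
      |cov[fun ω => f (restr X U ω), fun ω => g (restr X V ω); μ]| ≤
        κ * s ^ (-α) * (A * L' + A' * L)) :
    WeakArray m K α (κ * r₀) s₀ μ (fun i ω => r * X i ω) D where
  measurable i hi := (hX i hi).const_mul r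
  mean i hi := by rw [integral_const_mul, hmean i hi, mul_zero]
  integrable_rpow := hint
  moment_le := hK
  cov_le U V hU hV hUV s hs hd f g A A' L L' hf hg := by
    simp_rw [restr_const_mul]
    have hs0 : 0 ≤ s := hs₀.trans hs
    refine (hcov U V hU hV hUV s hs hd _ _ A A' (L * r) (L' * r) (hf.comp_mul hr)
      (hg.comp_mul hr)).trans ?_
    have h1 := mul_nonneg hg.nonneg hf.lip_nonneg
    have h2 := mul_nonneg hf.nonneg hg.lip_nonneg
    calc κ * s ^ (-α) * (A * (L' * r) + A' * (L * r)) =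
        κ * s ^ (-α) * (A * L' + A' * L) * r := by ring
      _ ≤ κ * s ^ (-α) * (A * L' + A' * L) * r₀ := by gcongr
      _ = _ := by ring

end Scaling

/-! ### Long-range covariances and the choice of the radius. -/

section LongRangeDecay

variable {E : Type*} [PseudoMetricSpace E] {D : ℕ → Finset E} {Ω : ℕ → Type*}
  [∀ n, MeasurableSpace (Ω n)] {μ : ∀ n, Measure (Ω n)} {X : ∀ n, E → Ω n → ℝ}

/-- The `θ` bound involves only the sup norm of `f` and the Lipschitz constant of `g`, so the size
of `U` does not matter and the covariance is of order `|D|^(-γβ)`. One needs `γ d < 1/2 < γ β`,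
possible exactly when `β > d`; `γ = 1/(d+β)` is such a choice. -/
theorem exists_longRange_of_theta {d β r₀ : ℝ} (hd : 0 < d) (hβ : d < β)
    (hD : Tendsto (fun n => (D n).card) atTop atTop)
    (h : IsBigOPow (fun s => ⨆ u : ℕ, thetaBar μ D X u 1 s) β) :
    ∃ γ δ C : ℝ, 0 < γ ∧ γ * d < 1 / 2 ∧ 1 / 2 < δ ∧ 0 ≤ C ∧ ∀ᶠ n in atTop,
      ∀ T Λ r, 0 ≤ T → 0 ≤ Λ → 0 ≤ r → r ≤ r₀ →
      LongRange (μ n) (fun i ω => r * X n i ω) (D n) T (((D n).card : ℝ) ^ γ)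
        (Λ / √((D n).card : ℝ)) (C * r₀ * (1 + T * Λ) * ((D n).card : ℝ) ^ (-δ)) := by
  obtain ⟨C, s₁, hC, hs₁, hb⟩ := exists_pair_singleton_le h
  have hβ0 : 0 < β := by linarith
  have hγ : 0 < 1 / (d + β) := by positivity
  refine ⟨1 / (d + β), 1 / (d + β) * β, C, hγ, ?_, ?_, hC, ?_⟩
  · rw [div_mul_eq_mul_div, div_lt_div_iff₀ (by linarith) two_pos]; linarith
  · rw [div_mul_eq_mul_div, div_lt_div_iff₀ two_pos (by linarith)]; linarith
  have hlim : Tendsto (fun n => ((D n).card : ℝ)) atTop atTop :=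
    tendsto_natCast_atTop_atTop.comp hD
  filter_upwards [((tendsto_rpow_atTop hγ).comp hlim).eventually_ge_atTop s₁] with n hn
  intro T Λ r hT hΛ hr hr₀ i hi U hU hdist f hf
  have hx : (0 : ℝ) ≤ (D n).card := Nat.cast_nonneg _
  rw [Function.comp_apply] at hn
  have hg := BddLip.comp_eval (abs_clip_le hT) (abs_clip_sub_clip_le T)
    (⟨i, Finset.mem_singleton_self i⟩ : ({i} : Finset E))
  have key := abs_cov_le_of_thetaPair_le (μ := μ n) (X := X n) (by positivity)
    (hb _ hn n U hU i hi hdist) (hf.comp_mul hr) (hg.comp_mul hr)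
  refine key.trans ?_
  rw [← Real.rpow_mul hx, Finset.card_singleton, mul_neg]
  have h1 : r ≤ r₀ * (1 + T * Λ) := hr₀.trans
    (le_mul_of_one_le_right (hr.trans hr₀) (by linarith [mul_nonneg hT hΛ]))
  calc _ = C * ((D n).card : ℝ) ^ (-(1 / (d + β) * β)) * r := by push_cast; ring
    _ ≤ C * ((D n).card : ℝ) ^ (-(1 / (d + β) * β)) * (r₀ * (1 + T * Λ)) := by gcongr
    _ = _ := by ring

/-- Here `|U|` times the Lipschitz constant of `f` enters and can be as large as `|D| · Λ/√|D| = Λ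
√|D|`. This loses a factor `√|D|`, so one needs `γ β > 1` together with `γ d < 1/2`, hence `β > 2d`;
`γ = 2/(2d+β)` satisfies both. -/
theorem exists_longRange_of_eta {d β r₀ : ℝ} (hd : 0 < d) (hβ : 2 * d < β)
    (hD : Tendsto (fun n => (D n).card) atTop atTop)
    (h : IsBigOPow (fun s => ⨆ u : ℕ, etaBar μ D X u 1 s) β) :
    ∃ γ δ C : ℝ, 0 < γ ∧ γ * d < 1 / 2 ∧ 1 / 2 < δ ∧ 0 ≤ C ∧ ∀ᶠ n in atTop,
      ∀ T Λ r, 0 ≤ T → 0 ≤ Λ → 0 ≤ r → r ≤ r₀ →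
      LongRange (μ n) (fun i ω => r * X n i ω) (D n) T (((D n).card : ℝ) ^ γ)
        (Λ / √((D n).card : ℝ)) (C * r₀ * (1 + T * Λ) * ((D n).card : ℝ) ^ (-δ)) := by
  obtain ⟨C, s₁, hC, hs₁, hb⟩ := exists_pair_singleton_le h
  have hβ0 : 0 < β := by linarith
  have hγ : 0 < 2 / (2 * d + β) := by positivity
  have hγβ : 1 < 2 / (2 * d + β) * β := by
    rw [div_mul_eq_mul_div, lt_div_iff₀ (by linarith)]; linarith
  refine ⟨2 / (2 * d + β), 2 / (2 * d + β) * β - 1 / 2, C, hγ, ?_, by linarith, hC, ?_⟩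
  · rw [div_mul_eq_mul_div, div_lt_div_iff₀ (by linarith) two_pos]; linarith
  have hlim : Tendsto (fun n => ((D n).card : ℝ)) atTop atTop :=
    tendsto_natCast_atTop_atTop.comp hD
  filter_upwards [((tendsto_rpow_atTop hγ).comp hlim).eventually_ge_atTop s₁,
    hlim.eventually_ge_atTop 1] with n hn hn1
  intro T Λ r hT hΛ hr hr₀ i hi U hU hdist f hf
  set x : ℝ := ((D n).card : ℝ) with hx
  have hx0 : 0 < x := by linarith
  rw [Function.comp_apply] at hn
  have hg := BddLip.comp_eval (abs_clip_le hT) (abs_clip_sub_clip_le T)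
    (⟨i, Finset.mem_singleton_self i⟩ : ({i} : Finset E))
  have key := abs_cov_le_of_etaPair_le (μ := μ n) (X := X n) (by positivity)
    (hb _ hn n U hU i hi hdist) (hf.comp_mul hr) (hg.comp_mul hr)
  refine key.trans ?_
  rw [← Real.rpow_mul hx0.le, Finset.card_singleton, mul_neg]
  have hU' : (U.card : ℝ) ≤ x := Nat.cast_le.2 (Finset.card_le_card hU)
  have hsq : 1 ≤ √x := Real.one_le_sqrt.2 hn1
  have hsq0 : 0 < √x := by linarith
  have h2 : (U.card : ℝ) * T * (Λ / √x * r) + ((1 : ℕ) : ℝ) * 1 * (1 * r) ≤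
      √x * (r₀ * (1 + T * Λ)) := by
    calc _ ≤ x * T * (Λ / √x * r₀) + ((1 : ℕ) : ℝ) * 1 * (1 * r₀) := by gcongr
      _ = √x * (r₀ * (T * Λ)) + r₀ := by
        nth_rw 1 [← Real.mul_self_sqrt hx0.le]
        push_cast
        field_simp
      _ ≤ √x * (r₀ * (T * Λ)) + √x * r₀ := by
        gcongr
        exact le_mul_of_one_le_left (hr.trans hr₀) hsq
      _ = _ := by ring
  have h3 : x ^ (-(2 / (2 * d + β) * β)) * √x = x ^ (-(2 / (2 * d + β) * β - 1 / 2)) := by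
    rw [Real.sqrt_eq_rpow, ← Real.rpow_add hx0]
    congr 1
    ring
  calc _ ≤ C * x ^ (-(2 / (2 * d + β) * β)) * (√x * (r₀ * (1 + T * Λ))) := by gcongr
    _ = _ := by rw [← h3]; ring

end LongRangeDecay

/-! ### Normalisation and conclusion. -/

theorem exists_pos_le_of_liminf_ofReal_pos {x : ℕ → ℝ}
    (h : 0 < liminf (fun n => ENNReal.ofReal (x n)) atTop) :
    ∃ c : ℝ, 0 < c ∧ ∀ᶠ n in atTop, c ≤ x n := by
  obtain ⟨b, hb0, hb⟩ := exists_between h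
  have hbt : b ≠ ∞ := (hb.trans_le le_top).ne
  refine ⟨b.toReal, ENNReal.toReal_pos hb0.ne' hbt, ?_⟩
  filter_upwards [eventually_lt_of_lt_liminf hb] with n hn
  exact ((ENNReal.lt_ofReal_iff_toReal_lt hbt).1 hn).le

theorem le_scale {E : Type*} (D : ℕ → Finset E) (c : ℕ → E → ℝ) {n : ℕ} {i : E} (hi : i ∈ D n) :
    c n i ≤ scale D c n :=
  le_ciSup (f := fun i : D n => c n i) (Set.finite_range _).bddAbove ⟨i, hi⟩

theorem integrable_and_integral_le_of_lintegral_le {Ω : Type*} [MeasurableSpace Ω] {μ : Measure Ω}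
    {F G : Ω → ℝ} {K : ℝ} (hF : Measurable F) (hK : 0 ≤ K) (hF0 : ∀ ω, 0 ≤ F ω)
    (hFG : ∀ ω, F ω ≤ G ω) (hG : ∫⁻ ω, ENNReal.ofReal (G ω) ∂μ ≤ ENNReal.ofReal K) :
    Integrable F μ ∧ ∫ ω, F ω ∂μ ≤ K := by
  have h : ∫⁻ ω, ENNReal.ofReal (F ω) ∂μ ≤ ENNReal.ofReal K :=
    (lintegral_mono fun ω => ENNReal.ofReal_le_ofReal (hFG ω)).trans hG
  refine ⟨⟨hF.aestronglyMeasurable, ?_⟩, ?_⟩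
  · rw [hasFiniteIntegral_iff_ofReal (.of_forall hF0)]
    exact h.trans_lt ENNReal.ofReal_lt_top
  · rw [integral_eq_lintegral_of_nonneg_ae (.of_forall hF0) hF.aestronglyMeasurable]
    exact ENNReal.toReal_le_of_le_ofReal hK h

/-- Since `c n i ≤ scale D c n`, dividing by the common scale only decreases the individually
normalised moments. -/
theorem exists_moment_bound {E : Type*} {D : ℕ → Finset E} {Ω : ℕ → Type*}
    [∀ n, MeasurableSpace (Ω n)] {μ : ∀ n, Measure (Ω n)} {X : ∀ n, E → Ω n → ℝ}
    (hX : ∀ n, ∀ i ∈ D n, Measurable (X n i)) {m : ℝ} (hm : 0 ≤ m) {c : ℕ → E → ℝ}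
    (hc : ∀ n, ∀ i ∈ D n, 0 < c n i)
    (hmoment : (⨆ (n : ℕ), ⨆ i ∈ D n,
      ∫⁻ ω, ENNReal.ofReal (|X n i ω / c n i| ^ m) ∂(μ n)) < ∞) :
    ∃ K : ℝ, 0 ≤ K ∧ ∀ n, ∀ i ∈ D n,
      Integrable (fun ω => |(scale D c n)⁻¹ * X n i ω| ^ m) (μ n) ∧
        ∫ ω, |(scale D c n)⁻¹ * X n i ω| ^ m ∂(μ n) ≤ K := by
  set κ := ⨆ (n : ℕ), ⨆ i ∈ D n, ∫⁻ ω, ENNReal.ofReal (|X n i ω / c n i| ^ m) ∂(μ n) with hκ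
  refine ⟨κ.toReal, ENNReal.toReal_nonneg, fun n i hi =>
    integrable_and_integral_le_of_lintegral_le (G := fun ω => |X n i ω / c n i| ^ m)
      ?_ ENNReal.toReal_nonneg (fun ω => by positivity) (fun ω => ?_) ?_⟩
  · have := hX n i hi
    fun_prop
  · have h1 := hc n i hi
    have h2 := le_scale D c hi
    have h3 : 0 < scale D c n := h1.trans_le h2
    refine Real.rpow_le_rpow (abs_nonneg _) ?_ hm
    rw [abs_mul, abs_div, abs_of_pos h1, abs_of_pos (inv_pos.2 h3), div_eq_inv_mul]
    gcongr
  · rw [ENNReal.ofReal_toReal hmoment.ne]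
    exact le_iSup_of_le n (le_iSup₂_of_le i hi le_rfl)

/-- Convergence in distribution to the standard Gaussian from convergence of the characteristic
functions. -/
theorem tendstoInDistribution_gaussian_of_tendsto_integral_exp {Ω : ℕ → Type*}
    [∀ n, MeasurableSpace (Ω n)] {μ : ∀ n, Measure (Ω n)} [∀ n, IsProbabilityMeasure (μ n)]
    {W : ∀ n, Ω n → ℝ} (hW : ∀ n, AEMeasurable (W n) (μ n))
    (h : ∀ t : ℝ, Tendsto (fun n => ∫ ω, Complex.exp (Complex.I * ((t * W n ω : ℝ) : ℂ)) ∂(μ n))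
      atTop (𝓝 (Complex.exp (-(t : ℂ) ^ 2 / 2)))) :
    TendstoInDistribution W atTop (id : ℝ → ℝ) μ (gaussianReal 0 1) where
  forall_aemeasurable := hW
  aemeasurable_limit := aemeasurable_id
  tendsto := by
    refine ProbabilityMeasure.tendsto_iff_tendsto_charFun.2 fun t => ?_
    simp only [ProbabilityMeasure.coe_mk, Measure.map_id, charFun_gaussianReal]
    have e1 : ∀ n, charFun ((μ n).map (W n)) t =
        ∫ ω, Complex.exp (Complex.I * ((t * W n ω : ℝ) : ℂ)) ∂(μ n) := by
      intro n
      rw [charFun_apply_real, integral_map (hW n) (by fun_prop)]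
      congr 1
      ext ω
      push_cast
      ring_nf
    simp_rw [e1]
    convert h t using 2
    push_cast
    ring_nf

/-- Convergence of the characteristic functions of the normalised sums, from covariance bounds at
short and long range. -/
theorem tendsto_integral_exp_of_bounds {E : Type*} [NormedAddCommGroup E] [NormedSpace ℝ E]
    [FiniteDimensional ℝ E] {L : Set E} (hL : IsLattice L) {D : ℕ → Finset E}
    (hDL : ∀ n, (D n : Set E) ⊆ L) (hD : Tendsto (fun n => (D n).card) atTop atTop)
    {Ω : ℕ → Type*} [∀ n, MeasurableSpace (Ω n)] {μ : ∀ n, Measure (Ω n)}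
    [∀ n, IsProbabilityMeasure (μ n)] {X : ∀ n, E → Ω n → ℝ}
    (hX : ∀ n, ∀ i ∈ D n, Measurable (X n i))
    (hmean : ∀ n, ∀ i ∈ D n, ∫ ω, X n i ω ∂(μ n) = 0)
    {M : ℕ → ℝ} {m K α κ s₀ r₀ c₀ γ δ C : ℝ} (hm : 2 < m) (hK0 : 0 ≤ K) (hκ : 0 ≤ κ) (hs₀ : 1 ≤ s₀)
    (hr₀ : 0 ≤ r₀) (hC : 0 ≤ C) (hM : ∀ᶠ n in atTop, 0 < M n ∧ (M n)⁻¹ ≤ r₀)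
    (hK : ∀ n, ∀ i ∈ D n, Integrable (fun ω => |(M n)⁻¹ * X n i ω| ^ m) (μ n) ∧
        ∫ ω, |(M n)⁻¹ * X n i ω| ^ m ∂(μ n) ≤ K)
    (hα : (m - 1) / (m - 2) * Module.finrank ℝ E < α) (hc₀ : 0 < c₀)
    (hvar : ∀ᶠ n in atTop, c₀ ≤ Var[partialSum D X n; μ n] / ((D n).card * M n ^ 2))
    (hcov : ∀ n, ∀ U V : Finset E, U ⊆ D n → V ⊆ D n →
      U.card + V.card ≤ 4 → ∀ s : ℝ, s₀ ≤ s → (∀ i ∈ U, ∀ j ∈ V, s ≤ dist i j) →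
      ∀ (f : (U → ℝ) → ℝ) (g : (V → ℝ) → ℝ) (A A' L L' : ℝ), BddLip f A L → BddLip g A' L' →
      |cov[fun ω => f (restr (X n) U ω), fun ω => g (restr (X n) V ω); μ n]| ≤
        κ * s ^ (-α) * (A * L' + A' * L))
    (hγ : 0 < γ) (hγd : γ * Module.finrank ℝ E < 1 / 2) (hδ : 1 / 2 < δ)
    (hlong : ∀ᶠ n in atTop, ∀ T Λ r, 0 ≤ T → 0 ≤ Λ → 0 ≤ r → r ≤ r₀ →
      LongRange (μ n) (fun i ω => r * X n i ω) (D n) T (((D n).card : ℝ) ^ γ)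
        (Λ / √((D n).card : ℝ)) (C * r₀ * (1 + T * Λ) * ((D n).card : ℝ) ^ (-δ))) (t : ℝ) :
    Tendsto (fun n => ∫ ω, Complex.exp (Complex.I *
      ((t * ((√Var[partialSum D X n; μ n])⁻¹ * partialSum D X n ω) : ℝ) : ℂ)) ∂(μ n))
      atTop (𝓝 (Complex.exp (-(t : ℂ) ^ 2 / 2))) := by
  have hx : Tendsto (fun n => ((D n).card : ℝ)) atTop atTop :=
    tendsto_natCast_atTop_atTop.comp hD
  have hsum : ∀ n ω, ∑ i ∈ D n, (M n)⁻¹ * X n i ω = (M n)⁻¹ * partialSum D X n ω := fun n ω => by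
    rw [partialSum, Finset.mul_sum]
  have hvarY : ∀ n, Var[fun ω => ∑ i ∈ D n, (M n)⁻¹ * X n i ω; μ n] =
      (M n)⁻¹ ^ 2 * Var[partialSum D X n; μ n] := fun n => by
    simp_rw [hsum]
    exact variance_const_mul _ _ _
  have key := tendsto_integral_exp_of_weakArray (Y := fun n i ω => (M n)⁻¹ * X n i ω) (μ := μ)
    (α := α) (κ := κ * r₀) (s₀ := s₀) (c₀ := c₀) (γ := γ) hL hDL hD hm hK0 (by positivity) hs₀
    (by
      rw [lt_div_iff₀ (by linarith)]
      rw [div_mul_eq_mul_div, div_lt_iff₀ (by linarith)] at hα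
      linarith)
    (by
      filter_upwards [hM] with n hn
      exact WeakArray.of_const_mul (inv_nonneg.2 hn.1.le) hn.2 hκ (by linarith) (hX n) (hmean n)
        (fun i hi => (hK n i hi).1) (fun i hi => (hK n i hi).2) (hcov n)) hc₀
    (by
      filter_upwards [hvar, hM, hx.eventually_gt_atTop 0] with n h1 h2 h3
      have hM2 := h2.1
      rw [hvarY, inv_pow, ← div_eq_inv_mul, le_div_iff₀ (by positivity)]
      rw [le_div_iff₀ (by positivity)] at h1
      linarith) hγ hγd
    (fun T hT Λ hΛ => by
      refine ⟨fun n => C * r₀ * (1 + T * Λ) * ((D n).card : ℝ) ^ (-δ), ?_, fun n => by positivity, ?_⟩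
      · have h1 := ((tendsto_rpow_neg_atTop (sub_pos.2 hδ)).comp hx).const_mul
          (C * r₀ * (1 + T * Λ))
        rw [mul_zero] at h1
        refine h1.congr' ?_
        filter_upwards [hx.eventually_gt_atTop 0] with n hn
        rw [Function.comp_apply, Real.sqrt_eq_rpow, mul_left_comm, ← Real.rpow_add hn]
        congr 2
        ring
      · filter_upwards [hlong, hM] with n h1 h2
        exact h1 T Λ _ hT.le hΛ (inv_nonneg.2 h2.1.le) h2.2) t
  -- The standardised sum is invariant under scaling, so the factor `(M n)⁻¹` cancels.
  refine key.congr' ?_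
  filter_upwards [hM] with n hn
  have hMn := hn.1
  refine integral_congr_ae (.of_forall fun ω => ?_)
  simp only []
  rw [hvarY, hsum, Real.sqrt_mul (by positivity), Real.sqrt_sq (by positivity)]
  congr 3
  field_simp

end WeakDep

end

theorem mainTheorem1
    {E : Type*} [NormedAddCommGroup E] [NormedSpace ℝ E] [FiniteDimensional ℝ E]
    (d : ℕ) (hd : 1 ≤ d) (hE : Module.finrank ℝ E = d)
    (L : Set E) (hL : WeakDep.IsLattice L)
    (D : ℕ → Finset E) (hDL : ∀ n, (D n : Set E) ⊆ L)
    (hD : Tendsto (fun n => (D n).card) atTop atTop)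
    {Ω : ℕ → Type*} [∀ n, MeasurableSpace (Ω n)]
    (μ : ∀ n, Measure (Ω n)) [∀ n, IsProbabilityMeasure (μ n)]
    (X : ∀ n, E → Ω n → ℝ) (hX : ∀ n, ∀ i ∈ D n, Measurable (X n i))
    (hmean : ∀ n, ∀ i ∈ D n, ∫ ω, X n i ω ∂(μ n) = 0)
    (m : ℝ) (hm : 2 < m)
    (c : ℕ → E → ℝ) (hc : ∀ n, ∀ i ∈ D n, 0 < c n i)
    (hmoment : (⨆ (n : ℕ), ⨆ i ∈ D n,
      ∫⁻ ω, ENNReal.ofReal (|X n i ω / c n i| ^ m) ∂(μ n)) < ∞)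
    (hscale : 0 < liminf (fun n => ENNReal.ofReal (WeakDep.scale D c n)) atTop)
    (hvar : 0 < liminf (fun n => ENNReal.ofReal
      (variance (WeakDep.partialSum D X n) (μ n) /
        ((D n).card * WeakDep.scale D c n ^ 2))) atTop)
    (hdep : WeakDep.PolyDecay (WeakDep.thetaBar μ D X) d m d ∨
      WeakDep.PolyDecay (WeakDep.etaBar μ D X) d m (2 * d)) :
    TendstoInDistribution
      (fun n ω => (√(variance (WeakDep.partialSum D X n) (μ n)))⁻¹ * WeakDep.partialSum D X n ω)
      atTop (id : ℝ → ℝ) μ (gaussianReal 0 1) := by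
  subst hE
  have hd0 : (0 : ℝ) < Module.finrank ℝ E := by exact_mod_cast hd
  obtain ⟨M₀, hM₀, hM⟩ := WeakDep.exists_pos_le_of_liminf_ofReal_pos hscale
  obtain ⟨c₀, hc₀, hv⟩ := WeakDep.exists_pos_le_of_liminf_ofReal_pos hvar
  obtain ⟨K, hK0, hK⟩ := WeakDep.exists_moment_bound hX (by linarith) hc hmoment
  have hMr : ∀ᶠ n in atTop, 0 < WeakDep.scale D c n ∧ (WeakDep.scale D c n)⁻¹ ≤ M₀⁻¹ := by
    filter_upwards [hM] with n hn
    exact ⟨hM₀.trans_le hn, inv_anti₀ hM₀ hn⟩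
  have hmeas : ∀ n, Measurable (WeakDep.partialSum D X n) := fun n =>
    Finset.measurable_fun_sum (D n) (hX n)
  refine WeakDep.tendstoInDistribution_gaussian_of_tendsto_integral_exp
    (fun n => ((hmeas n).const_mul _).aemeasurable) fun t => ?_
  rcases hdep with ⟨⟨α, hα, hshort⟩, β, hβ, hlong⟩ | ⟨⟨α, hα, hshort⟩, β, hβ, hlong⟩
  -- The `θ` bound lacks the term in `U.card` and the Lipschitz constant of `f`; adding this
  -- nonnegative term brings it to the `η` form, so both cases share the short-range argument.
  · obtain ⟨κ, s₀, hκ, hs₀, hcov⟩ := WeakDep.exists_short_range (X := X) (μ := μ)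
      (fun n U V f g A A' L L' τ hτ hp hf hg =>
        (WeakDep.abs_cov_le_of_thetaPair_le hτ hp hf hg).trans (by
          have := mul_nonneg (mul_nonneg (Nat.cast_nonneg (α := ℝ) U.card) hg.nonneg) hf.lip_nonneg
          gcongr
          linarith)) hshort
    obtain ⟨γ, δ, C, hγ, hγd, hδ, hC, hLR⟩ :=
      WeakDep.exists_longRange_of_theta (r₀ := M₀⁻¹) hd0 hβ hD hlong
    exact WeakDep.tendsto_integral_exp_of_bounds hL hDL hD hX hmean hm hK0 hκ hs₀
      (inv_nonneg.2 hM₀.le) hC hMr hK hα hc₀ hv hcov hγ hγd hδ hLR t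
  · obtain ⟨κ, s₀, hκ, hs₀, hcov⟩ := WeakDep.exists_short_range (X := X) (μ := μ)
      (fun n U V f g A A' L L' τ hτ hp hf hg => WeakDep.abs_cov_le_of_etaPair_le hτ hp hf hg) hshort
    obtain ⟨γ, δ, C, hγ, hγd, hδ, hC, hLR⟩ :=
      WeakDep.exists_longRange_of_eta (r₀ := M₀⁻¹) hd0 hβ hD hlong
    exact WeakDep.tendsto_integral_exp_of_bounds hL hDL hD hX hmean hm hK0 hκ hs₀
      (inv_nonneg.2 hM₀.le) hC hMr hK hα hc₀ hv hcov hγ hγd hδ hLR t
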